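/- Let $O=(X,Z,A,Y)\sim\mathbb P$, where $X$ takes values in a measurable space $\mathcal X$ (for example a subset of $\mathbb R^d$) and $Z,A,Y\in\{0,1\}$. Put $\lambda_z(x)=\mathbb P(Z=z\mid X=x)$ and $\pi_{ya.z}(x)=\mathbb P(Y=y,A=a\mid X=x,Z=z)$. The model $\mathcal M$ consists of all laws $\mathbb P$ of $O$ that satisfy positivity: for some $\delta>0$, $\lambda_1(X)\in[\delta,1-\delta]$ almost surely. Let $\theta_\ell=(\theta_{\ell,1},\dots,\theta_{\ell,8})$ and $\theta_u=(\theta_{u,1},\dots,\theta_{u,8})$ be the Balke–Pearl expressions \[ \begin{aligned} \theta_{\ell,1}&=\pi_{11.1}+\pi_{00.0}-1, & \theta_{u,1}&=1-\pi_{01.1}-\pi_{10.0},\\ \theta_{\ell,2}&=\pi_{11.0}+\pi_{00.1}-1, & \theta_{u,2}&=1-\pi_{01.0}-\pi_{10.1},\\ \theta_{\ell,3}&=-\pi_{01.1}-\pi_{10.1}, & \theta_{u,3}&=\pi_{11.1}+\pi_{00.1},\\ \theta_{\ell,4}&=-\pi_{01.0}-\pi_{10.0}, & \theta_{u,4}&=\pi_{11.0}+\pi_{00.0},\\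 \theta_{\ell,5}&=\pi_{11.0}-\pi_{11.1}-\pi_{10.1}-\pi_{01.0}-\pi_{10.0}, & \theta_{u,5}&=-\pi_{01.0}+\pi_{01.1}+\pi_{00.1}+\pi_{11.0}+\pi_{00.0},\\ \theta_{\ell,6}&=\pi_{11.1}-\pi_{11.0}-\pi_{10.0}-\pi_{01.1}-\pi_{10.1}, & \theta_{u,6}&=-\pi_{01.1}+\pi_{11.1}+\pi_{00.1}+\pi_{01.0}+\pi_{00.0},\\ \theta_{\ell,7}&=\pi_{00.1}-\pi_{01.1}-\pi_{10.1}-\pi_{01.0}-\pi_{00.0}, & \theta_{u,7}&=-\pi_{10.1}+\pi_{11.1}+\pi_{00.1}+\pi_{11.0}+\pi_{10.0},\\ \theta_{\ell,8}&=\pi_{00.0}-\pi_{01.0}-\pi_{10.0}-\pi_{01.1}-\pi_{00.1}, & \theta_{u,8}&=-\pi_{10.0}+\pi_{11.0}+\pi_{00.0}+\pi_{11.1}+\pi_{10.1}, \end{aligned} \] so that $\theta_\ell(x)\in[-2,1]^8$ and $\theta_u(x)\in[-1,2]^8$. Let \[ \psi_{ya.z}(O;\mathbb P)=\frac{\mathbf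 1(Z=z)}{\lambda_z(X)}\bigl\{\mathbf 1(Y=y,A=a)-\pi_{ya.z}(X)\bigr\}, \] and let $L_j(O;\mathbb P)$ and $U_j(O;\mathbb P)$ be obtained from $\theta_{\ell,j}$ and $\theta_{u,j}$ by replacing each $\pi_{ya.z}$ with $\psi_{ya.z}(O;\mathbb P)$ and omitting the constant $1$ where it occurs. A regular one-dimensional parametric submodel through $\mathbb P$ with score $u\in L^2(\mathbb P)$ is a family $(\mathbb P_t)_{t\in\mathbb R}$ of laws with $\mathbb P_0=\mathbb P$ that, for $t$ near $0$, lies in $\mathcal M$ and is dominated by one $\sigma$-finite measure $\nu$, and that is differentiable in quadratic mean at $0$: with $p_t=d\mathbb P_t/d\nu$, $\int\bigl(\tfrac{\sqrt{p_t}-\sqrt{p_0}}{t}-\tfrac12u\sqrt{p_0}\bigr)^2d\nu\to0$ as $t\to0$. A nonparametric influence function at $\mathbb P$ of a functional $\chi:\mathcal M\to\mathbb R$ is a function $\varphi$ of $O$ with mean zero and finite variance under $\mathbb P$ such that, for every such submodel, $t\mapsto\chi(\mathbb P_t)$ is differentiable at $0$ with derivative $\mathbb E_{\mathbb P}[\varphi(O)u(O)]$.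 **Theorem.** Let $\mathbb P\in\mathcal M$, and let $g:[-2,1]^8\to\mathbb R$ and $h:[-1,2]^8\to\mathbb R$ be continuously differentiable (with one-sided derivatives at the boundary). Then the functional $\mathcal L_g(\mathbb P)=\mathbb E_{\mathbb P}[g(\theta_\ell(X))]$ has at $\mathbb P$ the nonparametric influence function \[ \dot{\mathcal L}_g(O;\mathbb P)=g(\theta_\ell(X))-\mathcal L_g(\mathbb P)+\sum_{j=1}^8\partial_jg(\theta_\ell(X))\,L_j(O;\mathbb P), \] and it is the only one, up to $\mathbb P$-almost sure equality. Likewise, the functional $\mathcal U_h(\mathbb P)=\mathbb E_{\mathbb P}[h(\theta_u(X))]$ has at $\mathbb P$ the nonparametric influence function \[ \dot{\mathcal U}_h(O;\mathbb P)=h(\theta_u(X))-\mathcal U_h(\mathbb P)+\sum_{j=1}^8\partial_jh(\theta_u(X))\,U_j(O;\mathbb P), \] and it is the only one, up to $\mathbb P$-almost sure equality. -/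

import Mathlib

open MeasureTheory ProbabilityTheory Filter Topology

/-! ### Influence functions -/

/-- `path` is a regular one-dimensional parametric submodel of `model` through `P`, with score `u`:
near `t = 0` it stays in the model and is dominated by a σ-finite measure `ν`, and the root
densities `√(dPₜ/dν)` are differentiable in `L²(ν)` at `t = 0`, with derivative `½ u √(dP/dν)`
(differentiability in quadratic mean), where `u ∈ L²(P)`. -/
structure IsRegularSubmodel {Ω : Type*} [MeasurableSpace Ω] (model : Set (ProbabilityMeasure Ω))
    (P : ProbabilityMeasure Ω) (path : ℝ → ProbabilityMeasure Ω) (u : Ω → ℝ) : Prop where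
  through : path 0 = P
  mem_model : ∀ᶠ t in 𝓝 (0 : ℝ), path t ∈ model
  memLp_score : MemLp u 2 (P : Measure Ω)
  dqm : ∃ ν : Measure Ω, SigmaFinite ν ∧
    (∀ᶠ t in 𝓝 (0 : ℝ), (path t : Measure Ω) ≪ ν) ∧
    Tendsto (fun t : ℝ => eLpNorm (fun o : Ω =>
        (√((path t : Measure Ω).rnDeriv ν o).toReal - √((P : Measure Ω).rnDeriv ν o).toReal) / t
          - u o / 2 * √((P : Measure Ω).rnDeriv ν o).toReal) 2 ν)
      (𝓝[≠] 0) (𝓝 0)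

/-- `φ` is an influence function at `P` of the functional `χ` on the statistical model `model`:
it has mean zero and finite variance under `P`, and along every regular one-dimensional parametric
submodel `Pₜ` through `P`, with score `u`, the derivative of `χ(Pₜ)` at `t = 0` exists and
is `E_P[φ u]`. -/
structure IsInfluenceFunction {Ω : Type*} [MeasurableSpace Ω] (model : Set (ProbabilityMeasure Ω))
    (χ : ProbabilityMeasure Ω → ℝ) (P : ProbabilityMeasure Ω) (φ : Ω → ℝ) : Prop where
  memLp : MemLp φ 2 (P : Measure Ω)
  mean_zero : ∫ o, φ o ∂(P : Measure Ω) = 0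
  hasDerivAt : ∀ (path : ℝ → ProbabilityMeasure Ω) (u : Ω → ℝ),
    IsRegularSubmodel model P path u →
      HasDerivAt (fun t => χ (path t)) (∫ o, φ o * u o ∂(P : Measure Ω)) 0

/-! ### The observed data -/

/-- An observation `O = (X, Z, A, Y)`: covariates, binary instrument, exposure and outcome. -/
abbrev Obs (𝒳 : Type*) : Type _ := 𝒳 × Fin 2 × Fin 2 × Fin 2

namespace Obs

/-- The covariates `X`. -/
def covariates {𝒳 : Type*} (o : Obs 𝒳) : 𝒳 := o.1

/-- The instrument `Z`. -/
def instrument {𝒳 : Type*} (o : Obs 𝒳) : Fin 2 := o.2.1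

/-- The exposure `A`. -/
def exposure {𝒳 : Type*} (o : Obs 𝒳) : Fin 2 := o.2.2.1

/-- The outcome `Y`. -/
def outcome {𝒳 : Type*} (o : Obs 𝒳) : Fin 2 := o.2.2.2

end Obs

noncomputable section

/-- The instrument probabilities `λ_z(x) = P(Z = z ∣ X = x)`. -/
def instrProb {𝒳 : Type*} [MeasurableSpace 𝒳] (P : ProbabilityMeasure (Obs 𝒳)) (z : Fin 2)
    (x : 𝒳) : ℝ :=
  (condDistrib Obs.instrument Obs.covariates (P : Measure (Obs 𝒳)) x).real {z}

/-- `π_{ya.z}(x) = P(Y = y, A = a ∣ X = x, Z = z)`. -/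
def cellProb {𝒳 : Type*} [MeasurableSpace 𝒳] (P : ProbabilityMeasure (Obs 𝒳)) (x : 𝒳)
    (y a z : Fin 2) : ℝ :=
  (condDistrib (fun o : Obs 𝒳 => (o.outcome, o.exposure))
    (fun o : Obs 𝒳 => (o.covariates, o.instrument)) (P : Measure (Obs 𝒳)) (x, z)).real {(y, a)}

/-- The nonparametric model: all laws of `O` that satisfy positivity, i.e. for some `δ > 0`,
`λ_1(X) ∈ [δ, 1 - δ]` almost surely. -/
def positivityModel (𝒳 : Type*) [MeasurableSpace 𝒳] : Set (ProbabilityMeasure (Obs 𝒳)) :=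
  {P | ∃ δ : ℝ, 0 < δ ∧
    ∀ᵐ o ∂(P : Measure (Obs 𝒳)), instrProb P 1 o.covariates ∈ Set.Icc δ (1 - δ)}

/-- `ψ_{ya.z}(O; P) = 1(Z = z) / λ_z(X) * (1(Y = y, A = a) - π_{ya.z}(X))`. -/
def psi {𝒳 : Type*} [MeasurableSpace 𝒳] (P : ProbabilityMeasure (Obs 𝒳)) (o : Obs 𝒳)
    (y a z : Fin 2) : ℝ :=
  (if o.instrument = z then 1 else 0) / instrProb P z o.covariates *
    ((if o.outcome = y ∧ o.exposure = a then 1 else 0) - cellProb P o.covariates y a z)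

/-! ### The Balke–Pearl expressions -/

/-- The eight expressions of the Balke–Pearl lower bound, in the indeterminates `p y a z`, with the
additive constant `1` replaced by `c`. -/
def lowerForm (c : ℝ) (p : Fin 2 → Fin 2 → Fin 2 → ℝ) : Fin 8 → ℝ :=
  ![p 1 1 1 + p 0 0 0 - c,
    p 1 1 0 + p 0 0 1 - c,
    -p 0 1 1 - p 1 0 1,
    -p 0 1 0 - p 1 0 0,
    p 1 1 0 - p 1 1 1 - p 1 0 1 - p 0 1 0 - p 1 0 0,
    p 1 1 1 - p 1 1 0 - p 1 0 0 - p 0 1 1 - p 1 0 1,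
    p 0 0 1 - p 0 1 1 - p 1 0 1 - p 0 1 0 - p 0 0 0,
    p 0 0 0 - p 0 1 0 - p 1 0 0 - p 0 1 1 - p 0 0 1]

/-- The eight expressions of the Balke–Pearl upper bound, in the indeterminates `p y a z`, with the
additive constant `1` replaced by `c`. -/
def upperForm (c : ℝ) (p : Fin 2 → Fin 2 → Fin 2 → ℝ) : Fin 8 → ℝ :=
  ![c - p 0 1 1 - p 1 0 0,
    c - p 0 1 0 - p 1 0 1,
    p 1 1 1 + p 0 0 1,
    p 1 1 0 + p 0 0 0,
    -p 0 1 0 + p 0 1 1 + p 0 0 1 + p 1 1 0 + p 0 0 0,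
    -p 0 1 1 + p 1 1 1 + p 0 0 1 + p 0 1 0 + p 0 0 0,
    -p 1 0 1 + p 1 1 1 + p 0 0 1 + p 1 1 0 + p 1 0 0,
    -p 1 0 0 + p 1 1 0 + p 0 0 0 + p 1 1 1 + p 1 0 1]

/-- The vector `θ_ℓ(x)`. -/
def thetaLower {𝒳 : Type*} [MeasurableSpace 𝒳] (P : ProbabilityMeasure (Obs 𝒳)) (x : 𝒳) :
    Fin 8 → ℝ :=
  lowerForm 1 (cellProb P x)

/-- The vector `θ_u(x)`. -/
def thetaUpper {𝒳 : Type*} [MeasurableSpace 𝒳] (P : ProbabilityMeasure (Obs 𝒳)) (x : 𝒳) :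
    Fin 8 → ℝ :=
  upperForm 1 (cellProb P x)

/-- `L_j(O; P)`: `ψ` in place of `π` in `θ_{ℓ,j}`, the constant `1` omitted. -/
def corrLower {𝒳 : Type*} [MeasurableSpace 𝒳] (P : ProbabilityMeasure (Obs 𝒳)) (o : Obs 𝒳) :
    Fin 8 → ℝ :=
  lowerForm 0 (psi P o)

/-- `U_j(O; P)`: `ψ` in place of `π` in `θ_{u,j}`, the constant `1` omitted. -/
def corrUpper {𝒳 : Type*} [MeasurableSpace 𝒳] (P : ProbabilityMeasure (Obs 𝒳)) (o : Obs 𝒳) :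
    Fin 8 → ℝ :=
  upperForm 0 (psi P o)

/-- The cube `[-2, 1]⁸`, in which `θ_ℓ` takes its values. -/
def lowerCube : Set (Fin 8 → ℝ) := Set.Icc (fun _ => -2) (fun _ => 1)

/-- The cube `[-1, 2]⁸`, in which `θ_u` takes its values. -/
def upperCube : Set (Fin 8 → ℝ) := Set.Icc (fun _ => -1) (fun _ => 2)

/-- The partial derivative `∂_j f(v)` of a function `f` on the cube `K` (one-sided at the
boundary of `K`). -/
def partialDeriv (K : Set (Fin 8 → ℝ)) (f : (Fin 8 → ℝ) → ℝ) (j : Fin 8) (v : Fin 8 → ℝ) : ℝ :=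
  fderivWithin ℝ f K v (Pi.single j 1)

/-! ### The functionals and their influence functions -/

/-- `L_g(P) = E_P[g(θ_ℓ(X))]`. -/
def lowerFunctional {𝒳 : Type*} [MeasurableSpace 𝒳] (g : (Fin 8 → ℝ) → ℝ)
    (P : ProbabilityMeasure (Obs 𝒳)) : ℝ :=
  ∫ o, g (thetaLower P o.covariates) ∂(P : Measure (Obs 𝒳))

/-- `U_h(P) = E_P[h(θ_u(X))]`. -/
def upperFunctional {𝒳 : Type*} [MeasurableSpace 𝒳] (h : (Fin 8 → ℝ) → ℝ)
    (P : ProbabilityMeasure (Obs 𝒳)) : ℝ :=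
  ∫ o, h (thetaUpper P o.covariates) ∂(P : Measure (Obs 𝒳))

/-- `g(θ_ℓ(X)) - L_g(P) + ∑ⱼ ∂_j g(θ_ℓ(X)) L_j(O; P)`. -/
def lowerIF {𝒳 : Type*} [MeasurableSpace 𝒳] (g : (Fin 8 → ℝ) → ℝ)
    (P : ProbabilityMeasure (Obs 𝒳)) (o : Obs 𝒳) : ℝ :=
  g (thetaLower P o.covariates) - lowerFunctional g P +
    ∑ j : Fin 8, partialDeriv lowerCube g j (thetaLower P o.covariates) * corrLower P o j

/-- `h(θ_u(X)) - U_h(P) + ∑ⱼ ∂_j h(θ_u(X)) U_j(O; P)`. -/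
def upperIF {𝒳 : Type*} [MeasurableSpace 𝒳] (h : (Fin 8 → ℝ) → ℝ)
    (P : ProbabilityMeasure (Obs 𝒳)) (o : Obs 𝒳) : ℝ :=
  h (thetaUpper P o.covariates) - upperFunctional h P +
    ∑ j : Fin 8, partialDeriv upperCube h j (thetaUpper P o.covariates) * corrUpper P o j

end

/-! Both functionals have the form `E_P[F(π_P(X))]`, where `F` is a `C¹` function of the table of
cell probabilities, which ranges over a compact set. Write `d` for the gradient of `F` and `Ψ` for
the uncentred candidate `F(π_P) + ∑ d_c(π_P) ψ_c`, built from the fixed law `P`. Conditioning under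
another law `Q`, first on `(X, Z)` and then on `X`, gives `E_Q[Ψ] = E_Q[F(π_P) + ∑ d_c(π_P)
(λ_Q/λ_P)(π_Q - π_P)]`. Hence the functional at `Q` minus `E_Q[Ψ]` is a Taylor remainder of `F`
minus a sum of products of `λ_Q - λ_P` and `π_Q - π_P`: a von Mises expansion without first-order
term (`exists_abs_plugIn_sub_le`).

The remainder is controlled by a squared Hellinger distance `H`. Conditional probabilities under `P`
and `Q` differ in `L²(Q)` by `O(√H)` (`integral_condExp_sub_sq_le`,
`integral_indicator_cellProb_sub_sq_le`), and the covariate region where positivity of `P` fails has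
`Q`-mass at most `H`. Since `F` is only `C¹`, its Taylor remainder is `ε|Δ| + CΔ²` with arbitrary `ε
> 0`; the bound `|Δ| ≤ τ + Δ²/τ` with `τ = |t|` makes it `O(ε|t|) + O(t²)` when `H = O(t²)`.

Along a path differentiable in quadratic mean, `H = O(t²)`, and the expectation of any bounded
function `f` has derivative `E_P[f u]` (`exists_hellingerClose_and_tendsto`). Applied to `Ψ`,
bounded after truncation, this gives the derivative; centring costs nothing because scores have mean
zero.

For uniqueness, every bounded mean-zero `u` is, after scaling, the score of the path with densities
`1 + t u`, which for small `t` changes `P` by a factor at most 2 and so preserves positivity. Two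
influence functions therefore have equal inner products with all `1_s - P(s)`, hence equal integrals
over all events `s`. -/

/-! ### Square integrability and root densities -/

theorem sq_integral_mul_le {Ω : Type*} [MeasurableSpace Ω] {μ : Measure Ω} {f g : Ω → ℝ}
    (hf : MemLp f 2 μ) (hg : MemLp g 2 μ) :
    (∫ o, f o * g o ∂μ) ^ 2 ≤ (∫ o, f o ^ 2 ∂μ) * ∫ o, g o ^ 2 ∂μ := by
  have hfg : Integrable (fun o => f o * g o) μ := hf.integrable_mul hg
  have key : ∀ x : ℝ, 0 ≤ (∫ o, f o ^ 2 ∂μ) * (x * x) + (2 * ∫ o, f o * g o ∂μ) * x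
      + ∫ o, g o ^ 2 ∂μ := by
    intro x
    have h : ∫ o, (f o * x + g o) ^ 2 ∂μ = (∫ o, f o ^ 2 ∂μ) * (x * x)
        + (2 * ∫ o, f o * g o ∂μ) * x + ∫ o, g o ^ 2 ∂μ := by
      have : ∀ o, (f o * x + g o) ^ 2 = f o ^ 2 * (x * x) + (f o * g o) * (2 * x) + g o ^ 2 := by
        intro o; ring
      simp_rw [this]
      have h1 : Integrable (fun o => f o ^ 2 * (x * x)) μ := hf.integrable_sq.mul_const _
      have h2 : Integrable (fun o => (f o * g o) * (2 * x)) μ := hfg.mul_const _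
      have h12 : Integrable (fun o => f o ^ 2 * (x * x) + (f o * g o) * (2 * x)) μ := h1.add h2
      rw [integral_add h12 hg.integrable_sq, integral_add h1 h2, integral_mul_const,
        integral_mul_const]
      ring
    rw [← h]
    exact integral_nonneg fun o => sq_nonneg _
  have := discrim_le_zero key
  rw [discrim] at this
  linarith

theorem integral_sq_eq_eLpNorm_sq {Ω : Type*} [MeasurableSpace Ω] {μ : Measure Ω} {f : Ω → ℝ}
    (hf : MemLp f 2 μ) : ∫ o, f o ^ 2 ∂μ = (eLpNorm f 2 μ).toReal ^ 2 := by
  rw [hf.eLpNorm_eq_integral_rpow_norm (by norm_num) (by norm_num),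
    ENNReal.toReal_ofReal (by positivity)]
  have h0 : 0 ≤ ∫ o, f o ^ 2 ∂μ := integral_nonneg fun o => sq_nonneg _
  simp only [ENNReal.toReal_ofNat, Real.rpow_ofNat, Real.norm_eq_abs, sq_abs]
  rw [← Real.rpow_natCast, ← Real.rpow_mul h0]
  norm_num

/-- The root density of `Q` with respect to `ν`. -/
noncomputable def rootDensity {Ω : Type*} [MeasurableSpace Ω] (Q ν : Measure Ω) (o : Ω) : ℝ :=
  √(Q.rnDeriv ν o).toReal

section RootDensity

variable {Ω : Type*} [MeasurableSpace Ω] {Q ν : Measure Ω}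

theorem measurable_rootDensity : Measurable (rootDensity Q ν) :=
  (Measure.measurable_rnDeriv Q ν).ennreal_toReal.sqrt

theorem rootDensity_sq (o : Ω) : rootDensity Q ν o ^ 2 = (Q.rnDeriv ν o).toReal :=
  Real.sq_sqrt ENNReal.toReal_nonneg

theorem integral_mul_rootDensity_sq [SigmaFinite Q] [SigmaFinite ν] (hQ : Q ≪ ν) (f : Ω → ℝ) :
    ∫ o, f o * rootDensity Q ν o ^ 2 ∂ν = ∫ o, f o ∂Q := by
  rw [← integral_rnDeriv_smul hQ]
  simp_rw [rootDensity_sq, smul_eq_mul, mul_comm]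

theorem integrable_mul_rootDensity_sq [SigmaFinite Q] [SigmaFinite ν] (hQ : Q ≪ ν) {f : Ω → ℝ}
    (hf : Integrable f Q) : Integrable (fun o => f o * rootDensity Q ν o ^ 2) ν := by
  have := (integrable_rnDeriv_smul_iff (f := f) hQ).2 hf
  simpa [rootDensity_sq, smul_eq_mul, mul_comm] using this

/-- Membership in `L²(Q)` gives measurability only up to `Q`-null sets, which may have positive
`ν`-measure. On such a set the density vanishes `ν`-almost everywhere, so the product is still
almost everywhere measurable for `ν`. -/
theorem memLp_mul_rootDensity [SigmaFinite Q] [SigmaFinite ν] (hQ : Q ≪ ν) {f : Ω → ℝ}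
    (hf : MemLp f 2 Q) : MemLp (fun o => f o * rootDensity Q ν o) 2 ν := by
  have hm : AEStronglyMeasurable (fun o => f o * rootDensity Q ν o) ν := by
    obtain ⟨f', hf', hff'⟩ := hf.aestronglyMeasurable
    refine ⟨fun o => f' o * rootDensity Q ν o,
      hf'.mul measurable_rootDensity.stronglyMeasurable, ?_⟩
    have h1 : ∀ᵐ o ∂(ν.withDensity (Q.rnDeriv ν)), f o = f' o := by
      rw [Measure.withDensity_rnDeriv_eq _ _ hQ]; exact hff'
    rw [ae_withDensity_iff (Measure.measurable_rnDeriv Q ν)] at h1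
    filter_upwards [h1] with o ho
    by_cases h0 : Q.rnDeriv ν o = 0
    · simp [rootDensity, h0]
    · rw [ho h0]
  rw [memLp_two_iff_integrable_sq hm]
  simp_rw [mul_pow]
  exact integrable_mul_rootDensity_sq hQ hf.integrable_sq

theorem memLp_rootDensity [IsFiniteMeasure Q] [SigmaFinite ν] (hQ : Q ≪ ν) :
    MemLp (rootDensity Q ν) 2 ν := by
  simpa using memLp_mul_rootDensity (f := fun _ => (1 : ℝ)) hQ (memLp_const 1)

theorem integral_rootDensity_sq [IsProbabilityMeasure Q] [SigmaFinite ν] (hQ : Q ≪ ν) :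
    ∫ o, rootDensity Q ν o ^ 2 ∂ν = 1 := by
  simpa using integral_mul_rootDensity_sq hQ (fun _ => (1 : ℝ))

end RootDensity

/-! ### Laws close in Hellinger distance -/

/-- Expectations under `Q` and `P` differ by at most a multiple of a squared distance `H`. -/
def HellingerClose {Ω : Type*} [MeasurableSpace Ω] (P Q : Measure Ω) (H : ℝ) : Prop :=
  ∀ f : Ω → ℝ, Measurable f → (∃ B, ∀ o, |f o| ≤ B) →
    (∫ o, f o ∂Q - ∫ o, f o ∂P) ^ 2 ≤ H * (∫ o, f o ^ 2 ∂Q + ∫ o, f o ^ 2 ∂P)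

theorem memLp_two_of_bound {Ω : Type*} [MeasurableSpace Ω] {μ : Measure Ω} [IsFiniteMeasure μ]
    {f : Ω → ℝ} (hf : Measurable f) {B : ℝ} (hB : ∀ o, |f o| ≤ B) : MemLp f 2 μ :=
  MemLp.of_bound hf.aestronglyMeasurable B (Eventually.of_forall hB)

theorem integrable_of_bound {Ω : Type*} [MeasurableSpace Ω] {μ : Measure Ω} [IsFiniteMeasure μ]
    {f : Ω → ℝ} (hf : Measurable f) {B : ℝ} (hB : ∀ o, |f o| ≤ B) : Integrable f μ :=
  Integrable.of_bound hf.aestronglyMeasurable B (Eventually.of_forall hB)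

/-- Factor `f (q - p) = (√q - √p) · f (√q + √p)` and apply Cauchy–Schwarz, then `(a + b)² ≤ 2(a² +
b²)`. The later comparison of conditional probabilities uses only this inequality, not the
dominating measure. -/
theorem hellingerClose_rootDensity {Ω : Type*} [MeasurableSpace Ω] {P Q ν : Measure Ω}
    [IsProbabilityMeasure P] [IsProbabilityMeasure Q] [SigmaFinite ν] (hP : P ≪ ν) (hQ : Q ≪ ν) :
    HellingerClose P Q (2 * ∫ o, (rootDensity Q ν o - rootDensity P ν o) ^ 2 ∂ν) := by
  rintro f hf ⟨B, hB⟩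
  have hfP := memLp_two_of_bound (μ := P) hf hB
  have hfQ := memLp_two_of_bound (μ := Q) hf hB
  have hsP := memLp_mul_rootDensity hP hfP
  have hsQ := memLp_mul_rootDensity hQ hfQ
  have h1 : ∫ o, f o ∂Q - ∫ o, f o ∂P = ∫ o, (rootDensity Q ν o - rootDensity P ν o) *
      (f o * rootDensity Q ν o + f o * rootDensity P ν o) ∂ν := by
    rw [← integral_mul_rootDensity_sq hQ, ← integral_mul_rootDensity_sq hP, ← integral_sub
      (integrable_mul_rootDensity_sq hQ (integrable_of_bound hf hB))
      (integrable_mul_rootDensity_sq hP (integrable_of_bound hf hB))]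
    congr 1; ext o; ring
  have h2 : ∫ o, (f o * rootDensity Q ν o + f o * rootDensity P ν o) ^ 2 ∂ν ≤
      2 * (∫ o, f o ^ 2 ∂Q + ∫ o, f o ^ 2 ∂P) := by
    rw [← integral_mul_rootDensity_sq hQ, ← integral_mul_rootDensity_sq hP, ← integral_add
      (integrable_mul_rootDensity_sq hQ hfQ.integrable_sq)
      (integrable_mul_rootDensity_sq hP hfP.integrable_sq), ← integral_const_mul]
    refine integral_mono (hsQ.add hsP).integrable_sq
      (((integrable_mul_rootDensity_sq hQ hfQ.integrable_sq).add
      (integrable_mul_rootDensity_sq hP hfP.integrable_sq)).const_mul 2) fun o => ?_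
    nlinarith [sq_nonneg (f o * rootDensity Q ν o - f o * rootDensity P ν o)]
  rw [h1]
  refine (sq_integral_mul_le ((memLp_rootDensity hQ).sub (memLp_rootDensity hP))
    (hsQ.add hsP)).trans ?_
  have h0 : 0 ≤ ∫ o, (rootDensity Q ν o - rootDensity P ν o) ^ 2 ∂ν :=
    integral_nonneg fun o => sq_nonneg _
  simp only [Pi.sub_apply, Pi.add_apply]
  calc _ ≤ _ := mul_le_mul_of_nonneg_left h2 h0
    _ = _ := by ring

/-! ### Consequences of differentiability in quadratic mean -/

namespace IsRegularSubmodel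

variable {Ω : Type*} [MeasurableSpace Ω] {model : Set (ProbabilityMeasure Ω)}
  {P : ProbabilityMeasure Ω} {path : ℝ → ProbabilityMeasure Ω} {u : Ω → ℝ}

/-- Differentiability in quadratic mean, in terms of integrals of squares. -/
theorem exists_dominating (hS : IsRegularSubmodel model P path u) :
    ∃ ν : Measure Ω, SigmaFinite ν ∧ (P : Measure Ω) ≪ ν ∧
      (∀ᶠ t in 𝓝[≠] (0 : ℝ), (path t : Measure Ω) ≪ ν) ∧
      Tendsto (fun t : ℝ => ∫ o, ((rootDensity (path t) ν o - rootDensity P ν o) / t -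
        u o / 2 * rootDensity P ν o) ^ 2 ∂ν) (𝓝[≠] 0) (𝓝 0) := by
  obtain ⟨ν, hν, hdom, hlim⟩ := hS.dqm
  have hP : (P : Measure Ω) ≪ ν := by
    have := hdom.self_of_nhds
    rwa [hS.through] at this
  refine ⟨ν, hν, hP, hdom.filter_mono nhdsWithin_le_nhds, ?_⟩
  have h1 := ((ENNReal.continuousAt_toReal ENNReal.zero_ne_top).tendsto.comp hlim).pow 2
  rw [ENNReal.toReal_zero, zero_pow two_ne_zero] at h1
  refine h1.congr' ?_
  filter_upwards [hdom.filter_mono nhdsWithin_le_nhds] with t ht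
  refine (integral_sq_eq_eLpNorm_sq ?_).symm
  have h2 : MemLp (fun o => (rootDensity (path t) ν o - rootDensity P ν o) * t⁻¹) 2 ν :=
    ((memLp_rootDensity ht).sub (memLp_rootDensity hP)).mul_const _
  have h3 : MemLp (fun o => (u o / 2) * rootDensity P ν o) 2 ν := by
    refine memLp_mul_rootDensity hP ?_
    simpa [div_eq_mul_inv] using hS.memLp_score.mul_const (2⁻¹ : ℝ)
  simpa [div_eq_mul_inv, Function.comp_def] using! h2.sub h3

/-- With `w = u √p / 2` and `r` the remainder of the difference quotient, `√p_t - √p = t (r + w)`.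
As `r → 0` in `L²(ν)`, the squared Hellinger distance is `O(t²)`, and expectations of bounded
functions can be differentiated along the path. -/
theorem exists_hellingerClose_and_tendsto (hS : IsRegularSubmodel model P path u) :
    (∃ C : ℝ, 0 ≤ C ∧ ∀ᶠ t in 𝓝[≠] (0 : ℝ),
      HellingerClose (P : Measure Ω) (path t : Measure Ω) (C * t ^ 2)) ∧
    ∀ f : Ω → ℝ, Measurable f → (∃ B, ∀ o, |f o| ≤ B) →
      Tendsto (fun t : ℝ => (∫ o, f o ∂(path t : Measure Ω) - ∫ o, f o ∂(P : Measure Ω)) / t)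
        (𝓝[≠] 0) (𝓝 (∫ o, f o * u o ∂(P : Measure Ω))) := by
  obtain ⟨ν, hν, hP, hdom, hlim⟩ := hS.exists_dominating
  have hu2 : MemLp (fun o => u o / 2) 2 (P : Measure Ω) := by
    simpa [div_eq_mul_inv] using hS.memLp_score.mul_const (2⁻¹ : ℝ)
  have hw := memLp_mul_rootDensity hP hu2
  have hs0 := memLp_rootDensity hP
  set s0 := rootDensity (P : Measure Ω) ν with hs0_def
  set w : Ω → ℝ := fun o => u o / 2 * s0 o with hw_def
  set s : ℝ → Ω → ℝ := fun t => rootDensity (path t : Measure Ω) ν with hs_def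
  set r : ℝ → Ω → ℝ := fun t o => (s t o - s0 o) / t - w o with hr_def
  set W := ∫ o, w o ^ 2 ∂ν with hW_def
  have hW0 : 0 ≤ W := integral_nonneg fun o => sq_nonneg _
  have hs : ∀ t, (path t : Measure Ω) ≪ ν → MemLp (s t) 2 ν := fun t ht => memLp_rootDensity ht
  have hr : ∀ t, (path t : Measure Ω) ≪ ν → MemLp (r t) 2 ν := by
    intro t ht
    have h2 : MemLp (fun o => (s t o - s0 o) * t⁻¹) 2 ν := ((hs t ht).sub hs0).mul_const _
    simpa [div_eq_mul_inv, Function.comp_def, hr_def] using! h2.sub hw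
  have hdist : ∀ᶠ t in 𝓝[≠] (0 : ℝ),
      ∫ o, (s t o - s0 o) ^ 2 ∂ν ≤ 2 * (1 + W) * t ^ 2 := by
    filter_upwards [hdom, hlim.eventually_le_const one_pos, self_mem_nhdsWithin] with t ht h1 ht0
    have ht0 : t ≠ 0 := ht0
    have hle : ∫ o, (s t o - s0 o) ^ 2 ∂ν ≤ ∫ o, 2 * t ^ 2 * (r t o ^ 2 + w o ^ 2) ∂ν := by
      refine integral_mono ((hs t ht).sub hs0).integrable_sq
        (((hr t ht).integrable_sq.add hw.integrable_sq).const_mul _) fun o => ?_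
      have : s t o - s0 o = t * (r t o + w o) := by simp only [hr_def]; field_simp; ring
      simp only [this]
      nlinarith [mul_nonneg (sq_nonneg t) (sq_nonneg (r t o - w o))]
    refine hle.trans ?_
    rw [integral_const_mul, integral_add (hr t ht).integrable_sq hw.integrable_sq]
    have h1' : ∫ o, r t o ^ 2 ∂ν ≤ 1 := h1
    nlinarith [sq_nonneg t]
  refine ⟨⟨4 * (1 + W), by positivity, ?_⟩, ?_⟩
  · filter_upwards [hdist, hdom] with t h1 ht f hf hB
    refine (hellingerClose_rootDensity hP ht f hf hB).trans ?_
    refine mul_le_mul_of_nonneg_right ?_ (add_nonneg (integral_nonneg fun o => sq_nonneg _)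
      (integral_nonneg fun o => sq_nonneg _))
    have h1' : ∫ o, (rootDensity (path t : Measure Ω) ν o - s0 o) ^ 2 ∂ν ≤
      2 * (1 + W) * t ^ 2 := h1
    linarith
  · rintro f hf ⟨B, hB⟩
    have hB' : ∀ o, f o ^ 2 ≤ B ^ 2 := fun o => sq_le_sq' (abs_le.1 (hB o)).1 (abs_le.1 (hB o)).2
    have hfm : ∀ {v : Ω → ℝ}, MemLp v 2 ν → MemLp (fun o => f o * v o) 2 ν := by
      intro v hv
      refine MemLp.of_le_mul (c := B) hv (hf.aestronglyMeasurable.mul hv.aestronglyMeasurable)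
        (Eventually.of_forall fun o => ?_)
      rw [Real.norm_eq_abs, Real.norm_eq_abs, abs_mul]
      exact mul_le_mul_of_nonneg_right (hB o) (abs_nonneg _)
    have hfint : ∀ {v : Ω → ℝ}, MemLp v 2 ν →
        ∫ o, (f o * v o) ^ 2 ∂ν ≤ B ^ 2 * ∫ o, v o ^ 2 ∂ν := by
      intro v hv
      rw [← integral_const_mul]
      refine integral_mono (hfm hv).integrable_sq (hv.integrable_sq.const_mul _) fun o => ?_
      simp only [mul_pow]
      exact mul_le_mul_of_nonneg_right (hB' o) (sq_nonneg _)
    rw [← tendsto_sub_nhds_zero_iff]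
    suffices hsq : Tendsto (fun t : ℝ =>
        ((∫ o, f o ∂(path t : Measure Ω) - ∫ o, f o ∂(P : Measure Ω)) / t
          - ∫ o, f o * u o ∂(P : Measure Ω)) ^ 2) (𝓝[≠] 0) (𝓝 0) by
      have := hsq.sqrt
      simp only [Real.sqrt_sq_eq_abs, Real.sqrt_zero] at this
      exact (tendsto_zero_iff_abs_tendsto_zero _).2 this
    have hbound : Tendsto (fun t : ℝ => 8 * B ^ 2 * (∫ o, r t o ^ 2 ∂ν) +
        2 * (B ^ 2 * W) * (2 * (1 + W) * t ^ 2)) (𝓝[≠] 0) (𝓝 0) := by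
      have h2 : Tendsto (fun t : ℝ => 2 * (B ^ 2 * W) * (2 * (1 + W) * t ^ 2)) (𝓝[≠] 0)
          (𝓝 (2 * (B ^ 2 * W) * (2 * (1 + W) * 0 ^ 2))) :=
        ((by fun_prop : Continuous fun t : ℝ =>
          2 * (B ^ 2 * W) * (2 * (1 + W) * t ^ 2)).tendsto 0).mono_left nhdsWithin_le_nhds
      simpa using (hlim.const_mul (8 * B ^ 2)).add h2
    refine tendsto_of_tendsto_of_tendsto_of_le_of_le' tendsto_const_nhds hbound
      (Eventually.of_forall fun t => sq_nonneg _) ?_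
    filter_upwards [hdist, hdom, self_mem_nhdsWithin] with t h1 ht ht0
    have ht0 : t ≠ 0 := ht0
    have hR := hr t ht
    have hst := hs t ht
    have hA := (hfm hR).integrable_mul (hst.add hs0)
    have hC := (hfm hw).integrable_mul (hst.sub hs0)
    have hfu : Integrable (fun o => f o * u o) (P : Measure Ω) :=
      (memLp_two_of_bound hf hB).integrable_mul hS.memLp_score
    -- From `(s² - s0²)/t = (r + w)(s + s0)`: the part `2 w s0 = u s0²` yields `E_P[f u]`, leaving
    -- `r (s + s0) + w (s - s0)`. Each product has one factor tending to zero in `L²(ν)` and one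
    -- bounded there.
    have hdec : (∫ o, f o ∂(path t : Measure Ω) - ∫ o, f o ∂(P : Measure Ω)) / t
          - ∫ o, f o * u o ∂(P : Measure Ω) =
        (∫ o, (f o * r t o) * (s t o + s0 o) ∂ν) + ∫ o, (f o * w o) * (s t o - s0 o) ∂ν := by
      have hA' : Integrable (fun o => (f o * r t o) * (s t o + s0 o)) ν := hA
      have hC' : Integrable (fun o => (f o * w o) * (s t o - s0 o)) ν := hC
      have i1 := integrable_mul_rootDensity_sq ht
        (integrable_of_bound (μ := (path t : Measure Ω)) hf hB)
      have i2 := integrable_mul_rootDensity_sq hP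
        (integrable_of_bound (μ := (P : Measure Ω)) hf hB)
      have i12 : Integrable (fun o => (f o * rootDensity (path t : Measure Ω) ν o ^ 2 -
          f o * rootDensity (P : Measure Ω) ν o ^ 2) / t) ν := (i1.sub i2).div_const t
      rw [← integral_add hA' hC', ← integral_mul_rootDensity_sq ht,
        ← integral_mul_rootDensity_sq hP, ← integral_mul_rootDensity_sq hP, ← integral_sub i1 i2,
        ← integral_div, ← integral_sub i12 (integrable_mul_rootDensity_sq hP hfu)]
      congr 1
      ext o
      simp only [hr_def, hw_def, hs_def, hs0_def]
      field_simp
      ring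
    have hsum : ∫ o, (s t o + s0 o) ^ 2 ∂ν ≤ 4 := by
      have : ∫ o, (s t o + s0 o) ^ 2 ∂ν ≤ ∫ o, 2 * (s t o ^ 2 + s0 o ^ 2) ∂ν := by
        refine integral_mono (hst.add hs0).integrable_sq
          ((hst.integrable_sq.add hs0.integrable_sq).const_mul _) fun o => ?_
        nlinarith [sq_nonneg (s t o - s0 o)]
      rw [integral_const_mul, integral_add hst.integrable_sq hs0.integrable_sq,
        integral_rootDensity_sq ht, integral_rootDensity_sq hP] at this
      linarith
    have hX := sq_integral_mul_le (hfm hR) (hst.add hs0)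
    have hY := sq_integral_mul_le (hfm hw) (hst.sub hs0)
    simp only [Pi.add_apply, Pi.sub_apply] at hX hY
    have hr0 : 0 ≤ ∫ o, r t o ^ 2 ∂ν := integral_nonneg fun o => sq_nonneg _
    have hX' : (∫ o, (f o * r t o) * (s t o + s0 o) ∂ν) ^ 2 ≤ B ^ 2 * (∫ o, r t o ^ 2 ∂ν) * 4 :=
      hX.trans (mul_le_mul (hfint hR) hsum (integral_nonneg fun o => sq_nonneg _) (by positivity))
    have hY' : (∫ o, (f o * w o) * (s t o - s0 o) ∂ν) ^ 2 ≤
        B ^ 2 * W * (2 * (1 + W) * t ^ 2) :=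
      hY.trans (mul_le_mul (hfint hw) h1 (integral_nonneg fun o => sq_nonneg _) (by positivity))
    rw [hdec]
    have := add_sq_le (a := ∫ o, (f o * r t o) * (s t o + s0 o) ∂ν)
      (b := ∫ o, (f o * w o) * (s t o - s0 o) ∂ν)
    have hdef : ∫ o, ((rootDensity (path t : Measure Ω) ν o - s0 o) / t - w o) ^ 2 ∂ν
      = ∫ o, r t o ^ 2 ∂ν := rfl
    linarith

end IsRegularSubmodel

/-! ### Conditional probabilities of close laws -/

/-- The defining property of the conditional law, tested against bounded functions of `W`. Only the
target `γ` has to be standard Borel, so the covariate space stays arbitrary. -/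
theorem integral_mul_condDistrib {Ω β γ : Type*} [MeasurableSpace Ω] [MeasurableSpace β]
    [MeasurableSpace γ] [StandardBorelSpace γ] [Nonempty γ] {P : Measure Ω} [IsProbabilityMeasure P]
    {W : Ω → β} {V : Ω → γ} (hW : Measurable W) (hV : Measurable V) {s : Set γ}
    (hs : MeasurableSet s) {k : β → ℝ} (hk : Measurable k) (hkB : ∃ B, ∀ b, |k b| ≤ B) :
    ∫ o, k (W o) * (V ⁻¹' s).indicator (fun _ => (1 : ℝ)) o ∂P =
      ∫ o, k (W o) * (condDistrib V W P (W o)).real s ∂P := by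
  obtain ⟨B, hB⟩ := hkB
  have hi : Integrable ((V ⁻¹' s).indicator (fun _ => (1 : ℝ))) P :=
    (integrable_const _).indicator (hV hs)
  have hkW : StronglyMeasurable[MeasurableSpace.comap W inferInstance] (fun o => k (W o)) :=
    (hk.comp (comap_measurable W)).stronglyMeasurable
  have hint : Integrable ((fun o => k (W o)) * (V ⁻¹' s).indicator (fun _ => (1 : ℝ))) P :=
    hi.bdd_mul (hk.comp hW).aestronglyMeasurable (Eventually.of_forall fun o => hB (W o))
  have h1 := condExp_mul_of_stronglyMeasurable_left hkW hint hi
  have h2 := condDistrib_ae_eq_condExp (μ := P) hW hV hs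
  rw [← integral_condExp hW.comap_le (f := fun o => k (W o) * _)]
  refine integral_congr_ae ?_
  filter_upwards [h1, h2] with o h1 h2
  rw [h2]
  exact h1

namespace HellingerClose

variable {Ω : Type*} [MeasurableSpace Ω] {P Q : Measure Ω} {H : ℝ}

/-- For the indicator of a `P`-null set the inequality reads `Q(N)² ≤ H · Q(N)`. This controls the
mass that `Q` puts where positivity of `P` fails. -/
theorem measureReal_le (h : HellingerClose P Q H) (hH : 0 ≤ H) {N : Set Ω}
    (hN : MeasurableSet N) (hPN : P N = 0) : Q.real N ≤ H := by
  have := h (N.indicator fun _ => 1) (measurable_const.indicator hN)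
    ⟨1, fun o => by by_cases ho : o ∈ N <;> simp [ho]⟩
  have h2 : ∀ o, (N.indicator (fun _ => (1 : ℝ)) o) ^ 2 = N.indicator (fun _ => (1 : ℝ)) o := by
    intro o; by_cases ho : o ∈ N <;> simp [ho]
  simp only [h2, integral_indicator_const _ hN, smul_eq_mul, mul_one] at this
  simp only [measureReal_def P, hPN, ENNReal.toReal_zero, sub_zero, add_zero] at this
  by_contra! hlt
  nlinarith

/-- Versions of the conditional expectation of one variable under two close laws are close. -/
theorem integral_condExp_sub_sq_le [IsProbabilityMeasure P] [IsProbabilityMeasure Q]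
    (h : HellingerClose P Q H) (hH : 0 ≤ H) {β : Type*}
    [MeasurableSpace β] {W : Ω → β} (hW : Measurable W) {v : Ω → ℝ} (hv : Measurable v)
    (hv01 : ∀ o, v o ∈ Set.Icc (0 : ℝ) 1) {e e' : β → ℝ} (he : Measurable e) (he' : Measurable e')
    (he01 : ∀ b, e b ∈ Set.Icc (0 : ℝ) 1) (he01' : ∀ b, e' b ∈ Set.Icc (0 : ℝ) 1)
    (hP : ∀ k : β → ℝ, Measurable k → (∃ B, ∀ b, |k b| ≤ B) →
      ∫ o, k (W o) * v o ∂P = ∫ o, k (W o) * e (W o) ∂P)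
    (hQ : ∀ k : β → ℝ, Measurable k → (∃ B, ∀ b, |k b| ≤ B) →
      ∫ o, k (W o) * v o ∂Q = ∫ o, k (W o) * e' (W o) ∂Q) :
    ∫ o, (e' (W o) - e (W o)) ^ 2 ∂Q ≤ 4 * H := by
  set k : β → ℝ := fun b => e' b - e b with hk_def
  have hk : Measurable k := he'.sub he
  have hk1 : ∀ b, |k b| ≤ 1 := fun b => by
    rw [abs_le]; exact ⟨by linarith [(he01 b).2, (he01' b).1], by linarith [(he01 b).1, (he01' b).2]⟩
  have hbound : ∀ f : β → ℝ, (∀ b, f b ∈ Set.Icc (0 : ℝ) 1) → ∀ o, |k (W o) * (v o - f (W o))| ≤ 1 := by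
    intro f hf o
    rw [abs_mul]
    have : |v o - f (W o)| ≤ 1 := by
      rw [abs_le]
      exact ⟨by linarith [(hv01 o).1, (hf (W o)).2], by linarith [(hv01 o).2, (hf (W o)).1]⟩
    nlinarith [hk1 (W o), abs_nonneg (k (W o)), abs_nonneg (v o - f (W o))]
  have hsq : ∀ f : β → ℝ, (∀ b, f b ∈ Set.Icc (0 : ℝ) 1) → ∀ o,
      (k (W o) * (v o - f (W o))) ^ 2 ≤ k (W o) ^ 2 := by
    intro f hf o
    have : (v o - f (W o)) ^ 2 ≤ 1 := by nlinarith [(hv01 o).1, (hv01 o).2, (hf (W o)).1, (hf (W o)).2]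
    rw [mul_pow]
    nlinarith [sq_nonneg (k (W o))]
  have hmeas : ∀ f : β → ℝ, Measurable f → Measurable fun o => k (W o) * (v o - f (W o)) :=
    fun f hf => (hk.comp hW).mul (hv.sub (hf.comp hW))
  have hkk : ∀ (μ : Measure Ω) [IsProbabilityMeasure μ], Integrable (fun o => k (W o) ^ 2) μ :=
    fun μ _ => (memLp_two_of_bound (hk.comp hW) fun o => hk1 (W o)).integrable_sq
  have hsub : ∀ (μ : Measure Ω) [IsProbabilityMeasure μ] (f : β → ℝ), Measurable f →
      (∀ b, f b ∈ Set.Icc (0 : ℝ) 1) → ∫ o, k (W o) * (v o - f (W o)) ∂μ =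
        ∫ o, k (W o) * v o ∂μ - ∫ o, k (W o) * f (W o) ∂μ := by
    intro μ _ f hf hf01
    rw [← integral_sub]
    · simp_rw [mul_sub]
    · refine integrable_of_bound ((hk.comp hW).mul hv) (B := 1) fun o => ?_
      simpa using hbound (fun _ => 0) (fun _ => by simp) o
    · refine integrable_of_bound ((hk.comp hW).mul (hf.comp hW)) (B := 1) fun o => ?_
      rw [abs_mul, abs_of_nonneg (hf01 (W o)).1]
      nlinarith [hk1 (W o), abs_nonneg (k (W o)), (hf01 (W o)).1, (hf01 (W o)).2]
  have hdiff : ∀ (μ : Measure Ω) [IsProbabilityMeasure μ],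
      ∫ o, k (W o) * e' (W o) ∂μ - ∫ o, k (W o) * e (W o) ∂μ = ∫ o, k (W o) ^ 2 ∂μ := by
    intro μ _
    have hb : ∀ f : β → ℝ, Measurable f → (∀ b, f b ∈ Set.Icc (0 : ℝ) 1) →
        Integrable (fun o => k (W o) * f (W o)) μ := by
      intro f hf hf01
      refine integrable_of_bound ((hk.comp hW).mul (hf.comp hW)) (B := 1) fun o => ?_
      rw [abs_mul, abs_of_nonneg (hf01 (W o)).1]
      nlinarith [hk1 (W o), abs_nonneg (k (W o)), (hf01 (W o)).1, (hf01 (W o)).2]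
    rw [← integral_sub (hb e' he' he01') (hb e he he01)]
    congr 1; ext o; simp only [hk_def]; ring
  set SQ := ∫ o, k (W o) ^ 2 ∂Q with hSQ
  set SP := ∫ o, k (W o) ^ 2 ∂P with hSP
  have hSQ0 : 0 ≤ SQ := integral_nonneg fun o => sq_nonneg _
  have hSP0 : 0 ≤ SP := integral_nonneg fun o => sq_nonneg _
  have hest : ∀ f : β → ℝ, Measurable f → (∀ b, f b ∈ Set.Icc (0 : ℝ) 1) →
      (∫ o, k (W o) * (v o - f (W o)) ∂Q - ∫ o, k (W o) * (v o - f (W o)) ∂P) ^ 2 ≤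
        H * (SQ + SP) := by
    intro f hf hf01
    refine (h _ (hmeas f hf) ⟨1, hbound f hf01⟩).trans (mul_le_mul_of_nonneg_left ?_ hH)
    refine add_le_add ?_ ?_
    · exact integral_mono (memLp_two_of_bound (hmeas f hf) (hbound f hf01)).integrable_sq (hkk Q)
        (hsq f hf01)
    · exact integral_mono (memLp_two_of_bound (hmeas f hf) (hbound f hf01)).integrable_sq (hkk P)
        (hsq f hf01)
  -- The test function `k (v - e)` has `P`-mean zero and `Q`-mean `SQ`, while `k (v - e')` has
  -- `Q`-mean zero and `P`-mean `-SP`. So `SQ²` and `SP²` are both at most `H (SQ + SP)`; adding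
  -- gives `(SQ + SP)² ≤ 4H (SQ + SP)`, hence `SQ ≤ SQ + SP ≤ 4H`.
  have h1 := hest e he he01
  have h2 := hest e' he' he01'
  rw [hsub Q e he he01, hsub P e he he01, hP k hk ⟨1, hk1⟩, hQ k hk ⟨1, hk1⟩, hdiff Q, sub_self,
    sub_zero] at h1
  rw [hsub Q e' he' he01', hsub P e' he' he01', hP k hk ⟨1, hk1⟩, hQ k hk ⟨1, hk1⟩, sub_self,
    zero_sub, neg_sub, hdiff P] at h2
  change SQ ≤ 4 * H
  by_contra! hlt
  nlinarith [sq_nonneg (SQ - SP)]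

end HellingerClose

/-! ### Uniqueness of influence functions -/

/-- With `s = √(1 + x)` the left side is `(s - 1)²/2`, while `x² = (s - 1)²(s + 1)²` and `s + 1 ≥
1`. -/
theorem abs_sqrt_one_add_sub_le {x : ℝ} (hx : -1 ≤ x) : |√(1 + x) - 1 - x / 2| ≤ x ^ 2 / 2 := by
  have h0 : 0 ≤ 1 + x := by linarith
  set s := √(1 + x)
  have hs : s ^ 2 = 1 + x := Real.sq_sqrt h0
  have hs0 : 0 ≤ s := Real.sqrt_nonneg _
  have h1 : s - 1 - x / 2 = -((s - 1) ^ 2 / 2) := by linarith [show x = s ^ 2 - 1 by linarith]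
  rw [h1, abs_neg, abs_of_nonneg (by positivity)]
  have : x = (s - 1) * (s + 1) := by linarith
  rw [this, mul_pow]
  nlinarith [sq_nonneg (s - 1), mul_nonneg (sq_nonneg (s - 1)) (by positivity : 0 ≤ s ^ 2 + 2 * s)]

theorem one_add_mul_mem_Icc {x t : ℝ} (hx : |x| ≤ 1) (ht : |t| ≤ 1 / 2) :
    1 + t * x ∈ Set.Icc (1 / 2 : ℝ) 2 := by
  have : |t * x| ≤ 1 / 2 := by
    rw [abs_mul]; nlinarith [abs_nonneg x, abs_nonneg t]
  rw [abs_le] at this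
  exact ⟨by linarith [this.1], by linarith [this.2]⟩

section Tilt

variable {Ω : Type*} [MeasurableSpace Ω]

/-- The measure with density `1 + t u` with respect to `P`. -/
noncomputable def tiltMeasure (P : Measure Ω) (u : Ω → ℝ) (t : ℝ) : Measure Ω :=
  P.withDensity fun o => ENNReal.ofReal (1 + t * u o)

variable {P : Measure Ω} {u : Ω → ℝ} {t : ℝ}

theorem isProbabilityMeasure_tiltMeasure [IsProbabilityMeasure P] (hu : Measurable u) (hu1 : ∀ o, |u o| ≤ 1)
    (hu0 : ∫ o, u o ∂P = 0) (ht : |t| ≤ 1 / 2) : IsProbabilityMeasure (tiltMeasure P u t) := by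
  constructor
  have hi : Integrable u P := integrable_of_bound hu hu1
  have hi' : Integrable (fun o => 1 + t * u o) P := (integrable_const _).add (hi.const_mul t)
  rw [tiltMeasure, withDensity_apply _ MeasurableSet.univ, Measure.restrict_univ,
    ← ofReal_integral_eq_lintegral_ofReal hi'
      (Eventually.of_forall fun o => by
        have := (one_add_mul_mem_Icc (hu1 o) ht).1
        simp only [Pi.zero_apply]; linarith), integral_add (integrable_const _) (hi.const_mul t),
    integral_const_mul, hu0]
  simp

theorem le_tiltMeasure (hu1 : ∀ o, |u o| ≤ 1) (ht : |t| ≤ 1 / 2) {s : Set Ω}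
    (hs : MeasurableSet s) : P s ≤ 2 * tiltMeasure P u t s := by
  rw [tiltMeasure, withDensity_apply _ hs, ← lintegral_const_mul' _ _ (by simp),
    ← setLIntegral_one]
  refine lintegral_mono fun o => ?_
  have : (1 : ENNReal) = 2 * ENNReal.ofReal (1 / 2) := by
    rw [← ENNReal.ofReal_ofNat, ← ENNReal.ofReal_mul (by norm_num)]; norm_num
  rw [this]
  gcongr
  exact (one_add_mul_mem_Icc (hu1 o) ht).1

theorem tiltMeasure_le (hu1 : ∀ o, |u o| ≤ 1) (ht : |t| ≤ 1 / 2) {s : Set Ω}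
    (hs : MeasurableSet s) : tiltMeasure P u t s ≤ 2 * P s := by
  rw [tiltMeasure, withDensity_apply _ hs, ← setLIntegral_const]
  refine lintegral_mono fun o => ?_
  rw [← ENNReal.ofReal_ofNat]
  exact ENNReal.ofReal_le_ofReal (one_add_mul_mem_Icc (hu1 o) ht).2

/-- Taking `P` itself as dominating measure, the root density is `√(1 + t u)`, and its second-order
Taylor bound makes the remainder at most `|t|` almost everywhere. -/
theorem tendsto_eLpNorm_tiltMeasure [IsProbabilityMeasure P] (hu : Measurable u) (hu1 : ∀ o, |u o| ≤ 1) :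
    Tendsto (fun t : ℝ => eLpNorm (fun o : Ω =>
        (√((tiltMeasure P u t).rnDeriv P o).toReal - √(P.rnDeriv P o).toReal) / t
          - u o / 2 * √(P.rnDeriv P o).toReal) 2 P) (𝓝[≠] 0) (𝓝 0) := by
  have hlim : Tendsto (fun t : ℝ => ENNReal.ofReal |t|) (𝓝[≠] 0) (𝓝 0) := by
    have : Tendsto (fun t : ℝ => ENNReal.ofReal |t|) (𝓝 0) (𝓝 (ENNReal.ofReal |(0 : ℝ)|)) :=
      (ENNReal.continuous_ofReal.comp continuous_abs).tendsto 0
    simpa using this.mono_left nhdsWithin_le_nhds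
  have hsmall : ∀ᶠ t : ℝ in 𝓝[≠] 0, |t| ≤ 1 / 2 := by
    refine Filter.Eventually.filter_mono nhdsWithin_le_nhds ?_
    filter_upwards [Metric.closedBall_mem_nhds (0 : ℝ) (by norm_num : (0 : ℝ) < 1 / 2)] with t ht
    simpa using ht
  refine tendsto_of_tendsto_of_tendsto_of_le_of_le' tendsto_const_nhds hlim
    (Eventually.of_forall fun _ => zero_le) ?_
  filter_upwards [hsmall, self_mem_nhdsWithin] with t ht ht0
  have ht0 : t ≠ 0 := ht0
  have hd := Measure.rnDeriv_withDensity (ν := P) (f := fun o => ENNReal.ofReal (1 + t * u o))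
    (by fun_prop)
  have hb : ∀ᵐ o ∂P, ‖(√((tiltMeasure P u t).rnDeriv P o).toReal - √(P.rnDeriv P o).toReal) / t
          - u o / 2 * √(P.rnDeriv P o).toReal‖ ≤ |t| := by
    filter_upwards [hd, Measure.rnDeriv_self P] with o h1 h2
    have h3 := one_add_mul_mem_Icc (hu1 o) ht
    rw [tiltMeasure, h1, h2, ENNReal.toReal_ofReal (by linarith [h3.1])]
    have h4 := abs_sqrt_one_add_sub_le (x := t * u o) (by linarith [h3.1])
    have h5 : (√(1 + t * u o) - 1) / t - u o / 2 = (√(1 + t * u o) - 1 - t * u o / 2) / t := by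
      field_simp
    simp only [ENNReal.toReal_one, Real.sqrt_one, mul_one]
    rw [h5, Real.norm_eq_abs, abs_div, div_le_iff₀ (abs_pos.2 ht0)]
    refine h4.trans ?_
    have h6 : u o ^ 2 ≤ 1 := (sq_le_one_iff_abs_le_one _).2 (hu1 o)
    rw [abs_mul_abs_self]
    nlinarith [sq_nonneg t]
  have := eLpNorm_le_of_ae_bound (p := 2) hb
  simpa using this

end Tilt

/-- Influence functions are unique in models that contain all laws boundedly equivalent to `P`. -/
theorem IsInfluenceFunction.ae_eq {Ω : Type*} [MeasurableSpace Ω]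
    {model : Set (ProbabilityMeasure Ω)} {χ : ProbabilityMeasure Ω → ℝ} {P : ProbabilityMeasure Ω}
    (hmodel : ∀ Q : ProbabilityMeasure Ω,
      (∀ s, MeasurableSet s → (P : Measure Ω) s ≤ 2 * (Q : Measure Ω) s) →
      (∀ s, MeasurableSet s → (Q : Measure Ω) s ≤ 2 * (P : Measure Ω) s) → Q ∈ model)
    {φ φ' : Ω → ℝ} (hφ : IsInfluenceFunction model χ P φ)
    (hφ' : IsInfluenceFunction model χ P φ') : φ =ᵐ[(P : Measure Ω)] φ' := by
  have hscore : ∀ u : Ω → ℝ, Measurable u → (∀ o, |u o| ≤ 1) →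
      ∫ o, u o ∂(P : Measure Ω) = 0 → ∃ path, IsRegularSubmodel model P path u := by
    intro u hu hu1 hu0
    classical
    -- For `|t| > 1/2` the tilt need not be a positive measure; the value `P` there is arbitrary,
    -- since only `t` near 0 matters.
    set path : ℝ → ProbabilityMeasure Ω := fun t => if ht : |t| ≤ 1 / 2 then
      ⟨tiltMeasure P u t, isProbabilityMeasure_tiltMeasure hu hu1 hu0 ht⟩ else P
    have hpath : ∀ t, |t| ≤ 1 / 2 → (path t : Measure Ω) = tiltMeasure P u t := by
      intro t ht
      have : path t = ⟨tiltMeasure P u t, isProbabilityMeasure_tiltMeasure hu hu1 hu0 ht⟩ :=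
        dif_pos ht
      rw [this]
      rfl
    have hsmall : ∀ᶠ t : ℝ in 𝓝 0, |t| ≤ 1 / 2 := by
      filter_upwards [Metric.closedBall_mem_nhds (0 : ℝ) (by norm_num : (0 : ℝ) < 1 / 2)] with t ht
      simpa using ht
    refine ⟨path, ?_, ?_, memLp_two_of_bound hu hu1, (P : Measure Ω), inferInstance, ?_, ?_⟩
    · apply Subtype.ext
      change (path 0 : Measure Ω) = P
      rw [hpath 0 (by norm_num), tiltMeasure]
      simp
    · filter_upwards [hsmall] with t ht
      refine hmodel _ (fun s hs => ?_) (fun s hs => ?_)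
      · rw [hpath t ht]; exact le_tiltMeasure hu1 ht hs
      · rw [hpath t ht]; exact tiltMeasure_le hu1 ht hs
    · filter_upwards [hsmall] with t ht
      rw [hpath t ht]
      exact withDensity_absolutelyContinuous _ _
    · refine (tendsto_eLpNorm_tiltMeasure (P := (P : Measure Ω)) hu hu1).congr' ?_
      filter_upwards [hsmall.filter_mono nhdsWithin_le_nhds] with t ht
      rw [hpath t ht]
  have hi := hφ.memLp.integrable one_le_two
  have hi' := hφ'.memLp.integrable one_le_two
  refine Integrable.ae_eq_of_forall_setIntegral_eq _ _ hi hi' fun s hs _ => ?_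
  have hp : (P : Measure Ω).real s ∈ Set.Icc (0 : ℝ) 1 := ⟨measureReal_nonneg, measureReal_le_one⟩
  -- The centred indicator of `s` as score: against a mean-zero `f` it integrates to `∫ f` over `s`.
  obtain ⟨path, hpath⟩ := hscore
    (fun o => s.indicator (fun _ => (1 : ℝ)) o - (P : Measure Ω).real s)
    ((measurable_const.indicator hs).sub_const _)
    (fun o => by
      rw [abs_le]
      by_cases ho : o ∈ s <;> simp only [ho, Set.indicator_of_mem, Set.indicator_of_notMem,
        not_false_eq_true] <;> constructor <;> linarith [hp.1, hp.2])
    (by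
      rw [integral_sub ((integrable_const _).indicator hs) (integrable_const _),
        integral_indicator_const _ hs]
      simp)
  have hd := (hφ.hasDerivAt _ _ hpath).unique (hφ'.hasDerivAt _ _ hpath)
  have hcalc : ∀ f : Ω → ℝ, Integrable f (P : Measure Ω) → ∫ o, f o ∂(P : Measure Ω) = 0 →
      ∫ o, f o * (s.indicator (fun _ => (1 : ℝ)) o - (P : Measure Ω).real s) ∂(P : Measure Ω) =
        ∫ o in s, f o ∂(P : Measure Ω) := by
    intro f hf hf0
    have : ∀ o, f o * (s.indicator (fun _ => (1 : ℝ)) o - (P : Measure Ω).real s) =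
        s.indicator f o - f o * (P : Measure Ω).real s := by
      intro o; by_cases ho : o ∈ s <;> simp [ho, mul_sub]
    simp_rw [this]
    rw [integral_sub (hf.indicator hs) (hf.mul_const _), integral_mul_const, hf0,
      integral_indicator hs]
    simp
  rwa [hcalc φ hi hφ.mean_zero, hcalc φ' hi' hφ'.mean_zero] at hd

/-! ### Conditional probabilities of the observed data -/

section Cells

variable {𝒳 : Type*} [MeasurableSpace 𝒳]

theorem Obs.measurable_covariates : Measurable (Obs.covariates : Obs 𝒳 → 𝒳) := measurable_fst

theorem Obs.measurable_instrument : Measurable (Obs.instrument : Obs 𝒳 → Fin 2) :=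
  measurable_snd.fst

theorem Obs.measurable_exposure : Measurable (Obs.exposure : Obs 𝒳 → Fin 2) :=
  measurable_snd.snd.fst

theorem Obs.measurable_outcome : Measurable (Obs.outcome : Obs 𝒳 → Fin 2) :=
  measurable_snd.snd.snd

variable (P Q : ProbabilityMeasure (Obs 𝒳))

theorem measurable_instrProb (z : Fin 2) : Measurable (instrProb P z) :=
  (Kernel.measurable_coe _ (measurableSet_singleton z)).ennreal_toReal

theorem instrProb_mem_Icc (z : Fin 2) (x : 𝒳) : instrProb P z x ∈ Set.Icc (0 : ℝ) 1 :=
  ⟨measureReal_nonneg, measureReal_le_one⟩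

/-- Conditional distributions are Markov kernels, so this holds at every `x`, as does
`sum_cellProb`. That matters because versions belonging to `P` are later integrated under `Q`, which
may charge `P`-null sets. -/
theorem instrProb_zero_add_one (x : 𝒳) : instrProb P 0 x + instrProb P 1 x = 1 := by
  have := sum_measureReal_singleton (μ := condDistrib Obs.instrument Obs.covariates
    (P : Measure (Obs 𝒳)) x) Finset.univ
  rw [Fin.sum_univ_two] at this
  simpa [instrProb] using this

theorem measurable_cellProb_uncurry (y a : Fin 2) :
    Measurable fun b : 𝒳 × Fin 2 => cellProb P b.1 y a b.2 :=
  (Kernel.measurable_coe _ (measurableSet_singleton (y, a))).ennreal_toReal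

theorem measurable_cellProb (y a z : Fin 2) : Measurable fun x => cellProb P x y a z :=
  (measurable_cellProb_uncurry P y a).comp (measurable_id.prodMk measurable_const)

theorem cellProb_mem_Icc (x : 𝒳) (y a z : Fin 2) : cellProb P x y a z ∈ Set.Icc (0 : ℝ) 1 :=
  ⟨measureReal_nonneg, measureReal_le_one⟩

theorem sum_cellProb (x : 𝒳) (z : Fin 2) :
    ∑ y, ∑ a, cellProb P x y a z = 1 := by
  have := sum_measureReal_singleton (μ := condDistrib
    (fun o : Obs 𝒳 => (o.outcome, o.exposure))
    (fun o : Obs 𝒳 => (o.covariates, o.instrument)) (P : Measure (Obs 𝒳)) (x, z)) Finset.univ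
  rw [Fintype.sum_prod_type] at this
  simpa [cellProb] using this

theorem measurable_ite_instrument (z : Fin 2) :
    Measurable fun o : Obs 𝒳 => if o.instrument = z then (1 : ℝ) else 0 :=
  (measurable_of_finite fun z' : Fin 2 => if z' = z then (1 : ℝ) else 0).comp
    Obs.measurable_instrument

theorem measurable_ite_outcome_exposure (y a : Fin 2) :
    Measurable fun o : Obs 𝒳 => if o.outcome = y ∧ o.exposure = a then (1 : ℝ) else 0 :=
  (measurable_of_finite fun b : Fin 2 × Fin 2 => if b.1 = y ∧ b.2 = a then (1 : ℝ) else 0).comp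
    (Obs.measurable_outcome.prodMk Obs.measurable_exposure)

theorem measurable_psi (y a z : Fin 2) : Measurable fun o => psi P o y a z :=
  ((measurable_ite_instrument z).div ((measurable_instrProb P z).comp
    Obs.measurable_covariates)).mul ((measurable_ite_outcome_exposure y a).sub
    ((measurable_cellProb P y a z).comp Obs.measurable_covariates))

theorem integral_mul_ite_instrument (z : Fin 2) {k : 𝒳 → ℝ} (hk : Measurable k)
    (hkB : ∃ B, ∀ x, |k x| ≤ B) :
    ∫ o, k o.covariates * (if o.instrument = z then 1 else 0) ∂(P : Measure (Obs 𝒳)) =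
      ∫ o, k o.covariates * instrProb P z o.covariates ∂(P : Measure (Obs 𝒳)) := by
  refine Eq.trans ?_ (integral_mul_condDistrib (P := (P : Measure (Obs 𝒳)))
    Obs.measurable_covariates Obs.measurable_instrument (measurableSet_singleton z) hk hkB)
  refine integral_congr_ae (Eventually.of_forall fun o => ?_)
  by_cases h : o.instrument = z <;> simp [h]

theorem integral_mul_ite_outcome_exposure (y a : Fin 2) {k : 𝒳 × Fin 2 → ℝ} (hk : Measurable k)
    (hkB : ∃ B, ∀ b, |k b| ≤ B) :
    ∫ o, k (o.covariates, o.instrument) * (if o.outcome = y ∧ o.exposure = a then 1 else 0)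
        ∂(P : Measure (Obs 𝒳)) =
      ∫ o, k (o.covariates, o.instrument) * cellProb P o.covariates y a o.instrument
        ∂(P : Measure (Obs 𝒳)) := by
  have := integral_mul_condDistrib (P := (P : Measure (Obs 𝒳)))
    (W := fun o : Obs 𝒳 => (o.covariates, o.instrument))
    (V := fun o : Obs 𝒳 => (o.outcome, o.exposure))
    (Obs.measurable_covariates.prodMk Obs.measurable_instrument)
    (Obs.measurable_outcome.prodMk Obs.measurable_exposure) (measurableSet_singleton (y, a)) hk hkB
  refine Eq.trans ?_ this
  refine integral_congr_ae (Eventually.of_forall fun o => ?_)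
  by_cases h : o.outcome = y ∧ o.exposure = a <;> simp [Prod.ext_iff, h]

/-! ### Stability of the positivity model -/

variable {P Q}

/-- For `B = {λ_Q < δ/8}`: `δ P(B) ≤ P(B, Z = z) ≤ 2 Q(B, Z = z) ≤ (δ/4) Q(B)`. Together with `Q(B)
≤ 2 P(B)` this gives `Q(B) ≤ Q(B)/2`, so `Q(B) = 0`. -/
theorem ae_le_instrProb_of_le {δ : ℝ} (hδ : 0 < δ) (z : Fin 2)
    (hPQ : ∀ s, MeasurableSet s → (P : Measure (Obs 𝒳)) s ≤ 2 * (Q : Measure (Obs 𝒳)) s)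
    (hQP : ∀ s, MeasurableSet s → (Q : Measure (Obs 𝒳)) s ≤ 2 * (P : Measure (Obs 𝒳)) s)
    (h : ∀ᵐ o ∂(P : Measure (Obs 𝒳)), δ ≤ instrProb P z o.covariates) :
    ∀ᵐ o ∂(Q : Measure (Obs 𝒳)), δ / 8 ≤ instrProb Q z o.covariates := by
  set B : Set 𝒳 := {x | instrProb Q z x < δ / 8} with hB_def
  have hB : MeasurableSet B := measurableSet_lt (measurable_instrProb Q z) measurable_const
  have hXB : MeasurableSet (Obs.covariates ⁻¹' B : Set (Obs 𝒳)) := Obs.measurable_covariates hB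
  have hZ : MeasurableSet {o : Obs 𝒳 | o.instrument = z} :=
    Obs.measurable_instrument (measurableSet_singleton z)
  set k : 𝒳 → ℝ := B.indicator fun _ => 1
  have hk : Measurable k := measurable_const.indicator hB
  have hk1 : ∃ b, ∀ x, |k x| ≤ b := ⟨1, fun x => by by_cases hx : x ∈ B <;> simp [k, hx]⟩
  have hint : ∀ R : ProbabilityMeasure (Obs 𝒳),
      Integrable (fun o : Obs 𝒳 => k o.covariates * instrProb R z o.covariates)
        (R : Measure (Obs 𝒳)) := by
    intro R
    refine integrable_of_bound ((hk.comp Obs.measurable_covariates).mul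
      ((measurable_instrProb R z).comp Obs.measurable_covariates)) (B := 1) fun o => ?_
    rw [abs_le]
    have := instrProb_mem_Icc R z o.covariates
    by_cases hx : o.covariates ∈ B <;> simp only [k, hx, Set.indicator_of_mem,
      Set.indicator_of_notMem, not_false_eq_true] <;> constructor <;> linarith [this.1, this.2]
  have hkint : ∀ R : ProbabilityMeasure (Obs 𝒳),
      Integrable (fun o : Obs 𝒳 => k o.covariates) (R : Measure (Obs 𝒳)) := by
    intro R
    obtain ⟨b, hb⟩ := hk1
    exact integrable_of_bound (hk.comp Obs.measurable_covariates) fun o => hb _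
  have hkval : ∀ R : ProbabilityMeasure (Obs 𝒳), ∫ o : Obs 𝒳, k o.covariates
      ∂(R : Measure (Obs 𝒳)) = (R : Measure (Obs 𝒳)).real (Obs.covariates ⁻¹' B) := by
    intro R
    rw [← integral_indicator_one hXB]
    rfl
  have hcell : ∀ R : ProbabilityMeasure (Obs 𝒳),
      (R : Measure (Obs 𝒳)).real (Obs.covariates ⁻¹' B ∩ {o | o.instrument = z}) =
      ∫ o, k o.covariates * instrProb R z o.covariates ∂(R : Measure (Obs 𝒳)) := by
    intro R
    rw [← integral_mul_ite_instrument R z hk hk1, ← integral_indicator_one (hXB.inter hZ)]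
    congr 1
    ext o
    by_cases hx : o.covariates ∈ B <;> by_cases hz : o.instrument = z <;>
      simp [k, hx, hz]
  have hreal : ∀ {R R' : ProbabilityMeasure (Obs 𝒳)} {s : Set (Obs 𝒳)},
      (R : Measure (Obs 𝒳)) s ≤ 2 * (R' : Measure (Obs 𝒳)) s →
      (R : Measure (Obs 𝒳)).real s ≤ 2 * (R' : Measure (Obs 𝒳)).real s := by
    intro R R' s hs
    have := ENNReal.toReal_mono (ENNReal.mul_ne_top (by simp) (measure_ne_top _ _)) hs
    simpa [measureReal_def, ENNReal.toReal_mul] using this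
  have h1 := hreal (hPQ _ (hXB.inter hZ))
  have h2 := hreal (hQP _ hXB)
  rw [hcell, hcell] at h1
  have h3 : δ * (P : Measure (Obs 𝒳)).real (Obs.covariates ⁻¹' B) ≤
      ∫ o, k o.covariates * instrProb P z o.covariates ∂(P : Measure (Obs 𝒳)) := by
    rw [← hkval, ← integral_const_mul]
    refine integral_mono_ae ((hkint P).const_mul δ) (hint P) ?_
    filter_upwards [h] with o ho
    by_cases hx : o.covariates ∈ B <;> simp [k, hx, ho]
  have h4 : ∫ o, k o.covariates * instrProb Q z o.covariates ∂(Q : Measure (Obs 𝒳)) ≤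
      δ / 8 * (Q : Measure (Obs 𝒳)).real (Obs.covariates ⁻¹' B) := by
    rw [← hkval, ← integral_const_mul]
    refine integral_mono (hint Q) ((hkint Q).const_mul _) fun o => ?_
    by_cases hx : o.covariates ∈ B
    · have hx' : instrProb Q z o.covariates < δ / 8 := hx
      simp [k, hx, hx'.le]
    · simp [k, hx]
  have h5 : (Q : Measure (Obs 𝒳)).real (Obs.covariates ⁻¹' B) = 0 := by
    have h0 : 0 ≤ (Q : Measure (Obs 𝒳)).real (Obs.covariates ⁻¹' B) := measureReal_nonneg
    by_contra hne
    have hpos := lt_of_le_of_ne h0 (Ne.symm hne)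
    nlinarith
  rw [measureReal_eq_zero_iff] at h5
  rw [ae_iff]
  convert h5 using 2
  ext o
  simp [hB_def]

theorem mem_positivityModel_iff :
    P ∈ positivityModel 𝒳 ↔ ∃ δ : ℝ, 0 < δ ∧
      ∀ z, ∀ᵐ o ∂(P : Measure (Obs 𝒳)), δ ≤ instrProb P z o.covariates := by
  refine exists_congr fun δ => and_congr_right fun _ => ?_
  rw [Fin.forall_fin_two, ← eventually_and]
  refine eventually_congr (Eventually.of_forall fun o => ?_)
  have := instrProb_zero_add_one P o.covariates
  rw [Set.mem_Icc]
  constructor <;> rintro ⟨h1, h2⟩ <;> constructor <;> linarith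

theorem mem_positivityModel_of_le (hP : P ∈ positivityModel 𝒳)
    (hPQ : ∀ s, MeasurableSet s → (P : Measure (Obs 𝒳)) s ≤ 2 * (Q : Measure (Obs 𝒳)) s)
    (hQP : ∀ s, MeasurableSet s → (Q : Measure (Obs 𝒳)) s ≤ 2 * (P : Measure (Obs 𝒳)) s) :
    Q ∈ positivityModel 𝒳 := by
  rw [mem_positivityModel_iff] at hP ⊢
  obtain ⟨δ, hδ, h⟩ := hP
  exact ⟨δ / 8, by positivity, fun z => ae_le_instrProb_of_le hδ z hPQ hQP (h z)⟩

/-! ### Closeness of the conditional cell probabilities -/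

theorem integral_instrProb_sub_sq_le {H : ℝ} (hH : 0 ≤ H)
    (h : HellingerClose (P : Measure (Obs 𝒳)) (Q : Measure (Obs 𝒳)) H) (z : Fin 2) :
    ∫ o, (instrProb Q z o.covariates - instrProb P z o.covariates) ^ 2 ∂(Q : Measure (Obs 𝒳)) ≤
      4 * H :=
  h.integral_condExp_sub_sq_le hH Obs.measurable_covariates (measurable_ite_instrument z)
    (fun o => by split_ifs <;> simp) (measurable_instrProb P z) (measurable_instrProb Q z)
    (instrProb_mem_Icc P z) (instrProb_mem_Icc Q z)
    (fun _ hk hkB => integral_mul_ite_instrument P z hk hkB)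
    (fun _ hk hkB => integral_mul_ite_instrument Q z hk hkB)

theorem sq_sub_le_one {a b : ℝ} (ha : a ∈ Set.Icc (0 : ℝ) 1) (hb : b ∈ Set.Icc (0 : ℝ) 1) :
    (a - b) ^ 2 ≤ 1 := by
  nlinarith [ha.1, ha.2, hb.1, hb.2]

/-- Closeness of conditional probabilities given `(X, Z)` controls the squared difference at the
observed instrument. Restricting to `Z = z` and conditioning on `X` under `Q` produces the weight
`λ_{Q,z}`. -/
theorem integral_instrProb_mul_cellProb_sub_sq_le {H : ℝ} (hH : 0 ≤ H)
    (h : HellingerClose (P : Measure (Obs 𝒳)) (Q : Measure (Obs 𝒳)) H) (y a z : Fin 2) :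
    ∫ o, (cellProb Q o.covariates y a z - cellProb P o.covariates y a z) ^ 2 *
      instrProb Q z o.covariates ∂(Q : Measure (Obs 𝒳)) ≤ 4 * H := by
  have hW : Measurable fun o : Obs 𝒳 => (o.covariates, o.instrument) :=
    Obs.measurable_covariates.prodMk Obs.measurable_instrument
  have h1 := h.integral_condExp_sub_sq_le hH hW (measurable_ite_outcome_exposure y a)
    (fun o => by split_ifs <;> simp) (measurable_cellProb_uncurry P y a)
    (measurable_cellProb_uncurry Q y a) (fun b => cellProb_mem_Icc P _ _ _ _)
    (fun b => cellProb_mem_Icc Q _ _ _ _)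
    (fun _ hk hkB => integral_mul_ite_outcome_exposure P y a hk hkB)
    (fun _ hk hkB => integral_mul_ite_outcome_exposure Q y a hk hkB)
  refine le_trans ?_ h1
  have hm := ((measurable_cellProb Q y a z).sub (measurable_cellProb P y a z)).pow_const 2
  have hb : ∀ R R' : 𝒳 → ℝ, (∀ x, R x ∈ Set.Icc (0 : ℝ) 1) → (∀ x, R' x ∈ Set.Icc (0 : ℝ) 1) →
      ∀ x, |(R x - R' x) ^ 2| ≤ 1 := by
    intro R R' hR hR' x
    rw [abs_of_nonneg (sq_nonneg _)]
    exact sq_sub_le_one (hR x) (hR' x)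
  rw [← integral_mul_ite_instrument Q z (k := fun x =>
    (cellProb Q x y a z - cellProb P x y a z) ^ 2) hm ⟨1, fun x =>
      hb _ _ (fun x => cellProb_mem_Icc Q x y a z) (fun x => cellProb_mem_Icc P x y a z) x⟩]
  have hint : Integrable (fun o : Obs 𝒳 => (cellProb Q o.covariates y a o.instrument -
      cellProb P o.covariates y a o.instrument) ^ 2) (Q : Measure (Obs 𝒳)) := by
    refine integrable_of_bound ((((measurable_cellProb_uncurry Q y a).sub
      (measurable_cellProb_uncurry P y a)).pow_const 2).comp hW) (B := 1) fun o => ?_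
    rw [abs_of_nonneg (sq_nonneg _)]
    exact sq_sub_le_one (cellProb_mem_Icc _ _ _ _ _) (cellProb_mem_Icc _ _ _ _ _)
  refine integral_mono_of_nonneg (Eventually.of_forall fun o => ?_) hint
    (Eventually.of_forall fun o => ?_)
  · exact mul_nonneg (sq_nonneg _) (by split_ifs <;> simp)
  · dsimp only
    split_ifs with hz
    · rw [hz, mul_one]
    · rw [mul_zero]; exact sq_nonneg _

/-- The covariate values at which all instrument probabilities under `P` are at least `δ`. -/
def positivitySet (P : ProbabilityMeasure (Obs 𝒳)) (δ : ℝ) : Set 𝒳 :=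
  {x | ∀ z, δ ≤ instrProb P z x}

theorem measurableSet_positivitySet (δ : ℝ) : MeasurableSet (positivitySet P δ) := by
  have : positivitySet P δ = ⋂ z, {x | δ ≤ instrProb P z x} := by
    ext x; simp [positivitySet]
  rw [this]
  exact MeasurableSet.iInter fun z => measurableSet_le measurable_const (measurable_instrProb P z)

/-- The weight `λ_Q` is removed although only `λ_P` is bounded below: where `λ_Q` is small, `λ_Q -
λ_P` is large, and its `L²(Q)` norm is already controlled. -/
theorem integral_indicator_cellProb_sub_sq_le {H : ℝ} (hH : 0 ≤ H)
    (h : HellingerClose (P : Measure (Obs 𝒳)) (Q : Measure (Obs 𝒳)) H) {δ : ℝ} (hδ : 0 < δ)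
    (y a z : Fin 2) :
    ∫ o : Obs 𝒳, (positivitySet P δ).indicator
      (fun x => (cellProb Q x y a z - cellProb P x y a z) ^ 2) o.covariates
      ∂(Q : Measure (Obs 𝒳)) ≤ (8 / δ + 4 / δ ^ 2) * H := by
  have h1 := integral_instrProb_mul_cellProb_sub_sq_le hH h y a z
  have h2 := integral_instrProb_sub_sq_le hH h z
  have hX := Obs.measurable_covariates (𝒳 := 𝒳)
  have hΔ := ((measurable_cellProb Q y a z).sub (measurable_cellProb P y a z)).pow_const 2
  have hΔ1 : ∀ x, (cellProb Q x y a z - cellProb P x y a z) ^ 2 ≤ 1 := fun x =>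
    sq_sub_le_one (cellProb_mem_Icc _ _ _ _ _) (cellProb_mem_Icc _ _ _ _ _)
  have hΔ0 : ∀ x, 0 ≤ (cellProb Q x y a z - cellProb P x y a z) ^ 2 := fun x => sq_nonneg _
  have i1 : Integrable (fun o : Obs 𝒳 => (cellProb Q o.covariates y a z -
      cellProb P o.covariates y a z) ^ 2 * instrProb Q z o.covariates) (Q : Measure (Obs 𝒳)) := by
    refine integrable_of_bound ((hΔ.mul (measurable_instrProb Q z)).comp hX) (B := 1) fun o => ?_
    have h3 := instrProb_mem_Icc Q z o.covariates
    have h4 := hΔ0 o.covariates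
    rw [abs_of_nonneg (mul_nonneg h4 h3.1)]
    nlinarith [hΔ1 o.covariates, h3.1, h3.2]
  have i2 : Integrable (fun o : Obs 𝒳 => (instrProb Q z o.covariates -
      instrProb P z o.covariates) ^ 2) (Q : Measure (Obs 𝒳)) := by
    refine integrable_of_bound ((((measurable_instrProb Q z).sub
      (measurable_instrProb P z)).pow_const 2).comp hX) (B := 1) fun o => ?_
    rw [abs_of_nonneg (sq_nonneg _)]
    exact sq_sub_le_one (instrProb_mem_Icc _ _ _) (instrProb_mem_Icc _ _ _)
  have hle : ∫ o : Obs 𝒳, (positivitySet P δ).indicator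
      (fun x => (cellProb Q x y a z - cellProb P x y a z) ^ 2) o.covariates
      ∂(Q : Measure (Obs 𝒳)) ≤ ∫ o : Obs 𝒳, (2 / δ * ((cellProb Q o.covariates y a z -
      cellProb P o.covariates y a z) ^ 2 * instrProb Q z o.covariates) +
      1 / δ ^ 2 * (instrProb Q z o.covariates - instrProb P z o.covariates) ^ 2)
      ∂(Q : Measure (Obs 𝒳)) := by
    refine integral_mono_of_nonneg (Eventually.of_forall fun o =>
      Set.indicator_nonneg (fun x _ => hΔ0 x) _) ((i1.const_mul _).add (i2.const_mul _))
      (Eventually.of_forall fun o => ?_)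
    have h3 := instrProb_mem_Icc Q z o.covariates
    have h4 := hΔ0 o.covariates
    have h5 := hΔ1 o.covariates
    dsimp only
    by_cases hx : o.covariates ∈ positivitySet P δ
    · rw [Set.indicator_of_mem hx]
      have h6 : δ ≤ instrProb P z o.covariates := hx z
      generalize (cellProb Q o.covariates y a z - cellProb P o.covariates y a z) ^ 2 = v at *
      generalize instrProb Q z o.covariates = q at *
      generalize instrProb P z o.covariates = p at *
      -- Expand `(q - p + δ v)² ≥ 0`, then use `p ≥ δ` and `v² ≤ v`.
      have h7 : δ ^ 2 * v ≤ 2 * δ * (v * q) + (q - p) ^ 2 := by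
        nlinarith [sq_nonneg (q - p + δ * v), mul_nonneg h4 hδ.le, mul_nonneg (mul_nonneg h4 hδ.le)
          (sub_nonneg.2 h6), mul_nonneg (mul_nonneg hδ.le hδ.le) (mul_nonneg h4 (sub_nonneg.2 h5))]
      have h8 : 2 / δ * (v * q) + 1 / δ ^ 2 * (q - p) ^ 2 =
          (2 * δ * (v * q) + (q - p) ^ 2) / δ ^ 2 := by
        field_simp
      rw [h8, le_div_iff₀ (by positivity)]
      linarith
    · rw [Set.indicator_of_notMem hx]
      have := mul_nonneg h4 h3.1
      positivity
  refine hle.trans ?_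
  rw [integral_add (i1.const_mul _) (i2.const_mul _), integral_const_mul, integral_const_mul]
  have h5 := mul_le_mul_of_nonneg_left h1 (by positivity : 0 ≤ 2 / δ)
  have h6 := mul_le_mul_of_nonneg_left h2 (by positivity : 0 ≤ 1 / δ ^ 2)
  refine (add_le_add h5 h6).trans (le_of_eq ?_)
  ring

end Cells

/-! ### Differentiable functionals of the conditional cell probabilities -/

theorem exists_bound_mul {α : Type*} {f g : α → ℝ} (hf : ∃ B, ∀ x, |f x| ≤ B)
    (hg : ∃ B, ∀ x, |g x| ≤ B) : ∃ B, ∀ x, |f x * g x| ≤ B := by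
  obtain ⟨B, hB⟩ := hf
  obtain ⟨B', hB'⟩ := hg
  refine ⟨B * B', fun x => ?_⟩
  rw [abs_mul]
  exact mul_le_mul (hB x) (hB' x) (abs_nonneg _) ((abs_nonneg _).trans (hB x))

theorem exists_bound_of_mem_Icc {α : Type*} {f : α → ℝ} (hf : ∀ x, f x ∈ Set.Icc (0 : ℝ) 1) :
    ∃ B, ∀ x, |f x| ≤ B :=
  ⟨1, fun x => by rw [abs_of_nonneg (hf x).1]; exact (hf x).2⟩

theorem integrable_of_exists_bound {Ω : Type*} [MeasurableSpace Ω] {μ : Measure Ω}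
    [IsFiniteMeasure μ] {f : Ω → ℝ} (hf : Measurable f) (hB : ∃ B, ∀ o, |f o| ≤ B) :
    Integrable f μ :=
  let ⟨_, h⟩ := hB
  integrable_of_bound hf h

/-- The conditional probability tables of `(Y, A)` given `Z`. -/
def cellSimplex : Set (Fin 2 → Fin 2 → Fin 2 → ℝ) :=
  {p | (∀ y a z, 0 ≤ p y a z) ∧ ∀ z, ∑ y, ∑ a, p y a z = 1}

theorem le_one_of_mem_cellSimplex {p : Fin 2 → Fin 2 → Fin 2 → ℝ} (hp : p ∈ cellSimplex)
    (y a z : Fin 2) : p y a z ≤ 1 := by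
  rw [← hp.2 z]
  exact (Finset.single_le_sum (fun a _ => hp.1 y a z) (Finset.mem_univ a)).trans
    (Finset.single_le_sum (f := fun y => ∑ a, p y a z)
      (fun y _ => Finset.sum_nonneg fun a _ => hp.1 y a z) (Finset.mem_univ y))

theorem isCompact_cellSimplex : IsCompact cellSimplex := by
  refine (isCompact_Icc (a := (0 : Fin 2 → Fin 2 → Fin 2 → ℝ)) (b := 1)).of_isClosed_subset ?_
    fun p hp => ⟨fun y a z => hp.1 y a z, fun y a z => le_one_of_mem_cellSimplex hp y a z⟩
  simp only [cellSimplex, Set.ofPred_and, Set.ofPred_forall]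
  refine IsClosed.inter ?_ ?_
  · exact isClosed_iInter fun y => isClosed_iInter fun a => isClosed_iInter fun z =>
      isClosed_le continuous_const (by fun_prop)
  · exact isClosed_iInter fun z => isClosed_eq (by fun_prop) continuous_const

theorem ContinuousOn.measurable_comp {α β γ : Type*} [MeasurableSpace α] [TopologicalSpace β]
    [MeasurableSpace β] [BorelSpace β] [TopologicalSpace γ] [MeasurableSpace γ] [BorelSpace γ]
    {f : β → γ} {s : Set β} (hf : ContinuousOn f s) {θ : α → β} (hθ : Measurable θ)
    (hs : ∀ x, θ x ∈ s) : Measurable fun x => f (θ x) :=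
  (continuousOn_iff_continuous_domRestrict.1 hf).measurable.comp (hθ.subtype_mk (h := hs))

/-- `F` is differentiable on the probability tables with continuous gradient `d`, with a first order
expansion that is uniform over pairs of tables. -/
structure HasUniformGradient (F : (Fin 2 → Fin 2 → Fin 2 → ℝ) → ℝ)
    (d : (Fin 2 → Fin 2 → Fin 2 → ℝ) → Fin 2 × Fin 2 × Fin 2 → ℝ) : Prop where
  continuousOn : ContinuousOn F cellSimplex
  continuousOn_grad : ∀ c, ContinuousOn (fun p => d p c) cellSimplex
  expansion : ∀ ε : ℝ, 0 < ε → ∃ C : ℝ, 0 ≤ C ∧ ∀ p ∈ cellSimplex, ∀ p' ∈ cellSimplex,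
    |F p' - F p - ∑ c, d p c * (p' c.1 c.2.1 c.2.2 - p c.1 c.2.1 c.2.2)| ≤
      ε * ∑ c : Fin 2 × Fin 2 × Fin 2, |p' c.1 c.2.1 c.2.2 - p c.1 c.2.1 c.2.2| +
      C * ∑ c : Fin 2 × Fin 2 × Fin 2, (p' c.1 c.2.1 c.2.2 - p c.1 c.2.1 c.2.2) ^ 2

/-! ### Von Mises expansion of plug-in functionals -/

section PlugIn

variable {𝒳 : Type*} [MeasurableSpace 𝒳]

/-- `E_P[F(π(X))]` for a function `F` of the conditional cell probabilities. -/
noncomputable def plugIn (F : (Fin 2 → Fin 2 → Fin 2 → ℝ) → ℝ)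
    (P : ProbabilityMeasure (Obs 𝒳)) : ℝ :=
  ∫ o, F (cellProb P o.covariates) ∂(P : Measure (Obs 𝒳))

/-- The influence function of `plugIn F`, where `d` is the gradient of `F`. -/
noncomputable def plugInIF (F : (Fin 2 → Fin 2 → Fin 2 → ℝ) → ℝ)
    (d : (Fin 2 → Fin 2 → Fin 2 → ℝ) → Fin 2 × Fin 2 × Fin 2 → ℝ)
    (P : ProbabilityMeasure (Obs 𝒳)) (o : Obs 𝒳) : ℝ :=
  F (cellProb P o.covariates) - plugIn F P +
    ∑ c, d (cellProb P o.covariates) c * psi P o c.1 c.2.1 c.2.2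

/-- The uncentred influence function, set to zero where positivity with constant `δ` fails. -/
noncomputable def truncatedIF (F : (Fin 2 → Fin 2 → Fin 2 → ℝ) → ℝ)
    (d : (Fin 2 → Fin 2 → Fin 2 → ℝ) → Fin 2 × Fin 2 × Fin 2 → ℝ)
    (P : ProbabilityMeasure (Obs 𝒳)) (δ : ℝ) (o : Obs 𝒳) : ℝ :=
  (positivitySet P δ).indicator (fun x => F (cellProb P x)) o.covariates +
    ∑ c, (positivitySet P δ).indicator (fun x => d (cellProb P x) c) o.covariates *
      psi P o c.1 c.2.1 c.2.2

variable {P Q : ProbabilityMeasure (Obs 𝒳)} {δ : ℝ}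

theorem cellProb_mem_cellSimplex (P : ProbabilityMeasure (Obs 𝒳)) (x : 𝒳) :
    cellProb P x ∈ cellSimplex :=
  ⟨fun y a z => (cellProb_mem_Icc P x y a z).1, sum_cellProb P x⟩

theorem measurable_cellProb_pi (P : ProbabilityMeasure (Obs 𝒳)) : Measurable (cellProb P) :=
  measurable_pi_iff.2 fun y => measurable_pi_iff.2 fun a => measurable_pi_iff.2 fun z =>
    measurable_cellProb P y a z

theorem measurable_comp_cellProb {f : (Fin 2 → Fin 2 → Fin 2 → ℝ) → ℝ}
    (hf : ContinuousOn f cellSimplex) (P : ProbabilityMeasure (Obs 𝒳)) :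
    Measurable fun x => f (cellProb P x) :=
  hf.measurable_comp (measurable_cellProb_pi P) (cellProb_mem_cellSimplex P)

theorem exists_bound_cellSimplex {f : (Fin 2 → Fin 2 → Fin 2 → ℝ) → ℝ}
    (hf : ContinuousOn f cellSimplex) : ∃ B, 0 ≤ B ∧ ∀ p ∈ cellSimplex, |f p| ≤ B := by
  obtain ⟨B, hB⟩ := isCompact_cellSimplex.exists_bound_of_continuousOn hf
  exact ⟨max B 0, le_max_right _ _, fun p hp => (hB p hp).trans (le_max_left _ _)⟩

theorem abs_psi_le {o : Obs 𝒳} (hδ : 0 < δ) (ho : o.covariates ∈ positivitySet P δ)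
    (y a z : Fin 2) : |psi P o y a z| ≤ 1 / δ := by
  have h1 : δ ≤ instrProb P z o.covariates := ho z
  have h2 := cellProb_mem_Icc P o.covariates y a z
  rw [psi, abs_mul, abs_div, abs_of_pos (hδ.trans_le h1)]
  have h3 : |(if o.instrument = z then (1 : ℝ) else 0)| ≤ 1 := by split_ifs <;> simp
  have h4 : |(if o.outcome = y ∧ o.exposure = a then (1 : ℝ) else 0) -
      cellProb P o.covariates y a z| ≤ 1 := by
    rw [abs_le]; split_ifs <;> constructor <;> linarith [h2.1, h2.2]
  calc _ ≤ 1 / δ * 1 := by gcongr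
    _ = _ := mul_one _

/-- The correction term `ψ` under another law: a weighted difference of cell probabilities. -/
theorem integral_indicator_mul_psi (hδ : 0 < δ) {k : 𝒳 → ℝ} (hk : Measurable k)
    (hkB : ∃ B, ∀ x, |k x| ≤ B) (y a z : Fin 2) :
    ∫ o : Obs 𝒳, (positivitySet P δ).indicator k o.covariates * psi P o y a z
        ∂(Q : Measure (Obs 𝒳)) =
      ∫ o : Obs 𝒳, (positivitySet P δ).indicator k o.covariates *
        (instrProb Q z o.covariates / instrProb P z o.covariates) *
        (cellProb Q o.covariates y a z - cellProb P o.covariates y a z)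
        ∂(Q : Measure (Obs 𝒳)) := by
  set w : 𝒳 → ℝ := fun x => (positivitySet P δ).indicator k x / instrProb P z x with hw_def
  have hw : Measurable w :=
    (hk.indicator (measurableSet_positivitySet δ)).div (measurable_instrProb P z)
  have hwB : ∃ B, ∀ x, |w x| ≤ B := by
    obtain ⟨B, hB⟩ := hkB
    refine ⟨B / δ, fun x => ?_⟩
    have hB0 : 0 ≤ B := (abs_nonneg _).trans (hB x)
    by_cases hx : x ∈ positivitySet P δ
    · have h1 : δ ≤ instrProb P z x := hx z
      simp only [hw_def, Set.indicator_of_mem hx, abs_div, abs_of_pos (hδ.trans_le h1)]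
      exact div_le_div₀ hB0 (hB x) hδ h1
    · simp only [hw_def, Set.indicator_of_notMem hx, zero_div, abs_zero]
      positivity
  have hX := Obs.measurable_covariates (𝒳 := 𝒳)
  have hpP : ∃ B, ∀ x, |cellProb P x y a z| ≤ B :=
    exists_bound_of_mem_Icc fun x => cellProb_mem_Icc P x y a z
  have hpQ : ∃ B, ∀ x, |cellProb Q x y a z| ≤ B :=
    exists_bound_of_mem_Icc fun x => cellProb_mem_Icc Q x y a z
  -- Keeping `1(Z = z)` inside the weight makes it a function of `(X, Z)`. Conditioning on `(X, Z)`
  -- turns the outcome–exposure indicator into `π_Q`, evaluated at `z`; conditioning on `X` then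
  -- turns `1(Z = z)` into `λ_Q`.
  set K : 𝒳 × Fin 2 → ℝ := fun b => w b.1 * (if b.2 = z then 1 else 0) with hK_def
  have hK : Measurable K := (hw.comp measurable_fst).mul
    ((measurable_of_finite fun z' : Fin 2 => if z' = z then (1 : ℝ) else 0).comp measurable_snd)
  have hKB : ∃ B, ∀ b, |K b| ≤ B :=
    exists_bound_mul (f := fun b : 𝒳 × Fin 2 => w b.1)
      (hwB.imp fun B h b => h b.1) (exists_bound_of_mem_Icc fun b => by split_ifs <;> simp)
  have e1 := integral_mul_ite_outcome_exposure Q y a hK hKB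
  have e2 := integral_mul_ite_instrument Q z (hw.mul (measurable_cellProb Q y a z))
    (exists_bound_mul hwB hpQ)
  have e3 := integral_mul_ite_instrument Q z (hw.mul (measurable_cellProb P y a z))
    (exists_bound_mul hwB hpP)
  have i1 : Integrable (fun o : Obs 𝒳 => K (o.covariates, o.instrument) *
      (if o.outcome = y ∧ o.exposure = a then 1 else 0)) (Q : Measure (Obs 𝒳)) :=
    integrable_of_exists_bound ((hK.comp (hX.prodMk Obs.measurable_instrument)).mul
      (measurable_ite_outcome_exposure y a))
      (exists_bound_mul (hKB.imp fun B h o => h (o.covariates, o.instrument))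
        (exists_bound_of_mem_Icc fun b => by split_ifs <;> simp))
  have i2 : Integrable (fun o : Obs 𝒳 => w o.covariates * cellProb P o.covariates y a z *
      (if o.instrument = z then 1 else 0)) (Q : Measure (Obs 𝒳)) :=
    integrable_of_exists_bound (((hw.mul (measurable_cellProb P y a z)).comp hX).mul
      (measurable_ite_instrument z))
      (exists_bound_mul ((exists_bound_mul hwB hpP).imp fun B h o => h o.covariates)
        (exists_bound_of_mem_Icc fun b => by split_ifs <;> simp))
  have i3 : ∀ R : ProbabilityMeasure (Obs 𝒳), Integrable (fun o : Obs 𝒳 =>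
      w o.covariates * cellProb R o.covariates y a z * instrProb Q z o.covariates)
      (Q : Measure (Obs 𝒳)) := fun R =>
    integrable_of_exists_bound (((hw.mul (measurable_cellProb R y a z)).mul
      (measurable_instrProb Q z)).comp hX)
      (exists_bound_mul ((exists_bound_mul hwB (exists_bound_of_mem_Icc fun x =>
        cellProb_mem_Icc R x y a z)).imp fun B h o => h o.covariates)
        (exists_bound_of_mem_Icc fun o => instrProb_mem_Icc Q z o.covariates))
  have e4 : ∫ o : Obs 𝒳, K (o.covariates, o.instrument) *
      cellProb Q o.covariates y a o.instrument ∂(Q : Measure (Obs 𝒳)) =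
      ∫ o : Obs 𝒳, (w * fun x => cellProb Q x y a z) o.covariates *
        (if o.instrument = z then 1 else 0) ∂(Q : Measure (Obs 𝒳)) := by
    refine integral_congr_ae (Eventually.of_forall fun o => ?_)
    by_cases hz : o.instrument = z <;> simp [hK_def, hz]
  calc _ = ∫ o : Obs 𝒳, (K (o.covariates, o.instrument) *
        (if o.outcome = y ∧ o.exposure = a then 1 else 0) -
        w o.covariates * cellProb P o.covariates y a z *
        (if o.instrument = z then 1 else 0)) ∂(Q : Measure (Obs 𝒳)) := by
        refine integral_congr_ae (Eventually.of_forall fun o => ?_)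
        simp only [psi, hK_def, hw_def]
        ring
    _ = ∫ o : Obs 𝒳, (w o.covariates * cellProb Q o.covariates y a z *
          instrProb Q z o.covariates - w o.covariates * cellProb P o.covariates y a z *
          instrProb Q z o.covariates) ∂(Q : Measure (Obs 𝒳)) := by
        rw [integral_sub i1 i2, integral_sub (i3 Q) (i3 P), e1, e4]
        exact congrArg₂ _ e2 e3
    _ = _ := by
        refine integral_congr_ae (Eventually.of_forall fun o => ?_)
        simp only [hw_def]
        ring

/-- Trades a first-order error for a second-order one. With `τ` of the order of the `L²` size of
`a`, both terms have that order after integration. -/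
theorem abs_le_add_sq_div (a : ℝ) {τ : ℝ} (hτ : 0 < τ) : |a| ≤ τ + a ^ 2 / τ := by
  have h : 0 ≤ a ^ 2 / τ := by positivity
  rcases le_total |a| τ with h1 | h1
  · linarith
  · have : |a| ≤ a ^ 2 / τ := by
      rw [le_div_iff₀ hτ, ← sq_abs]
      nlinarith [abs_nonneg a]
    linarith

variable {F : (Fin 2 → Fin 2 → Fin 2 → ℝ) → ℝ}
  {d : (Fin 2 → Fin 2 → Fin 2 → ℝ) → Fin 2 × Fin 2 × Fin 2 → ℝ}

theorem HasUniformGradient.exists_bound (hF : HasUniformGradient F d) :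
    ∃ B, 0 ≤ B ∧ ∀ p ∈ cellSimplex, |F p| ≤ B ∧ ∀ c, |d p c| ≤ B := by
  obtain ⟨B, hB0, hB⟩ := exists_bound_cellSimplex hF.continuousOn
  choose B' hB0' hB' using fun c => exists_bound_cellSimplex (hF.continuousOn_grad c)
  have hs : 0 ≤ ∑ c, B' c := Finset.sum_nonneg fun c _ => hB0' c
  refine ⟨B + ∑ c, B' c, by positivity, fun p hp => ⟨?_, fun c => ?_⟩⟩
  · linarith [hB p hp]
  · have := Finset.single_le_sum (fun c _ => hB0' c) (Finset.mem_univ c)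
    linarith [hB' c p hp]

theorem measurable_truncatedIF (hF : HasUniformGradient F d) :
    Measurable (truncatedIF F d P δ) := by
  have hX := Obs.measurable_covariates (𝒳 := 𝒳)
  have hS := measurableSet_positivitySet (P := P) δ
  refine (((measurable_comp_cellProb hF.continuousOn P).indicator hS).comp hX).add
    (Finset.measurable_sum _ fun c _ => ?_)
  exact (((measurable_comp_cellProb (hF.continuousOn_grad c) P).indicator hS).comp hX).mul
    (measurable_psi P _ _ _)

/-- The truncation makes the bound hold at every point rather than `P`-almost surely, as is needed
to integrate under the other laws of a path. -/
theorem exists_bound_truncatedIF (hF : HasUniformGradient F d) (hδ : 0 < δ) :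
    ∃ B, ∀ o, |truncatedIF F d P δ o| ≤ B := by
  obtain ⟨B, hB0, hB⟩ := hF.exists_bound
  refine ⟨B + ∑ _c : Fin 2 × Fin 2 × Fin 2, B * (1 / δ), fun o => ?_⟩
  have hs := hB _ (cellProb_mem_cellSimplex P o.covariates)
  refine (abs_add_le _ _).trans (add_le_add ?_ ((Finset.abs_sum_le_sum_abs _ _).trans
    (Finset.sum_le_sum fun c _ => ?_)))
  · by_cases ho : o.covariates ∈ positivitySet P δ
    · rw [Set.indicator_of_mem ho]; exact hs.1
    · rw [Set.indicator_of_notMem ho, abs_zero]; exact hB0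
  · rw [abs_mul]
    by_cases ho : o.covariates ∈ positivitySet P δ
    · rw [Set.indicator_of_mem ho]
      exact mul_le_mul (hs.2 c) (abs_psi_le hδ ho _ _ _) (abs_nonneg _) hB0
    · rw [Set.indicator_of_notMem ho, abs_zero, zero_mul]; positivity

theorem integral_truncatedIF (hF : HasUniformGradient F d) (hδ : 0 < δ) :
    Integrable (fun o : Obs 𝒳 => (positivitySet P δ).indicator
      (fun x => F (cellProb P x)) o.covariates + ∑ c, (positivitySet P δ).indicator
      (fun x => d (cellProb P x) c) o.covariates *
        (instrProb Q c.2.2 o.covariates / instrProb P c.2.2 o.covariates) *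
        (cellProb Q o.covariates c.1 c.2.1 c.2.2 - cellProb P o.covariates c.1 c.2.1 c.2.2))
      (Q : Measure (Obs 𝒳)) ∧
    ∫ o, truncatedIF F d P δ o ∂(Q : Measure (Obs 𝒳)) =
      ∫ o : Obs 𝒳, ((positivitySet P δ).indicator (fun x => F (cellProb P x)) o.covariates +
      ∑ c, (positivitySet P δ).indicator (fun x => d (cellProb P x) c) o.covariates *
        (instrProb Q c.2.2 o.covariates / instrProb P c.2.2 o.covariates) *
        (cellProb Q o.covariates c.1 c.2.1 c.2.2 - cellProb P o.covariates c.1 c.2.1 c.2.2))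
      ∂(Q : Measure (Obs 𝒳)) := by
  obtain ⟨B, hB0, hB⟩ := hF.exists_bound
  have hX := Obs.measurable_covariates (𝒳 := 𝒳)
  have hS := measurableSet_positivitySet (P := P) δ
  have hd := fun c => measurable_comp_cellProb (hF.continuousOn_grad c) P
  have hbd : ∀ {f : 𝒳 → ℝ}, (∀ x, |f x| ≤ B) → ∀ x, |(positivitySet P δ).indicator f x| ≤ B := by
    intro f hf x
    by_cases hx : x ∈ positivitySet P δ
    · rw [Set.indicator_of_mem hx]; exact hf x
    · rw [Set.indicator_of_notMem hx, abs_zero]; exact hB0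
  have i0 : Integrable (fun o : Obs 𝒳 => (positivitySet P δ).indicator
      (fun x => F (cellProb P x)) o.covariates) (Q : Measure (Obs 𝒳)) :=
    integrable_of_bound (((measurable_comp_cellProb hF.continuousOn P).indicator hS).comp hX)
      fun o => hbd (fun x => (hB _ (cellProb_mem_cellSimplex P x)).1) o.covariates
  have i1 : ∀ c : Fin 2 × Fin 2 × Fin 2, Integrable (fun o : Obs 𝒳 => (positivitySet P δ).indicator
      (fun x => d (cellProb P x) c) o.covariates * psi P o c.1 c.2.1 c.2.2)
      (Q : Measure (Obs 𝒳)) := by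
    intro c
    refine integrable_of_bound ((((hd c).indicator hS).comp hX).mul (measurable_psi P _ _ _))
      (B := B * (1 / δ)) fun o => ?_
    rw [abs_mul]
    by_cases ho : o.covariates ∈ positivitySet P δ
    · exact mul_le_mul (hbd (fun x => (hB _ (cellProb_mem_cellSimplex P x)).2 c) _)
        (abs_psi_le hδ ho _ _ _) (abs_nonneg _) hB0
    · rw [Set.indicator_of_notMem ho, abs_zero, zero_mul]; positivity
  have i2 : ∀ c : Fin 2 × Fin 2 × Fin 2, Integrable (fun o : Obs 𝒳 => (positivitySet P δ).indicator
      (fun x => d (cellProb P x) c) o.covariates *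
        (instrProb Q c.2.2 o.covariates / instrProb P c.2.2 o.covariates) *
        (cellProb Q o.covariates c.1 c.2.1 c.2.2 - cellProb P o.covariates c.1 c.2.1 c.2.2))
      (Q : Measure (Obs 𝒳)) := by
    intro c
    refine integrable_of_bound (((((hd c).indicator hS).mul ((measurable_instrProb Q _).div
      (measurable_instrProb P _))).mul ((measurable_cellProb Q _ _ _).sub
      (measurable_cellProb P _ _ _))).comp hX) (B := B * (1 / δ) * 1) fun o => ?_
    rw [abs_mul, abs_mul]
    have h1 := cellProb_mem_Icc P o.covariates c.1 c.2.1 c.2.2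
    have h2 := cellProb_mem_Icc Q o.covariates c.1 c.2.1 c.2.2
    have h3 : |cellProb Q o.covariates c.1 c.2.1 c.2.2 -
        cellProb P o.covariates c.1 c.2.1 c.2.2| ≤ 1 := by
      rw [abs_le]; constructor <;> linarith [h1.1, h1.2, h2.1, h2.2]
    refine mul_le_mul ?_ h3 (abs_nonneg _) (by positivity)
    by_cases ho : o.covariates ∈ positivitySet P δ
    · refine mul_le_mul (hbd (fun x => (hB _ (cellProb_mem_cellSimplex P x)).2 c) _) ?_
        (abs_nonneg _) hB0
      have h4 : δ ≤ instrProb P c.2.2 o.covariates := ho _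
      have h5 := instrProb_mem_Icc Q c.2.2 o.covariates
      rw [abs_div, abs_of_pos (hδ.trans_le h4), abs_of_nonneg h5.1]
      exact div_le_div₀ zero_le_one h5.2 hδ h4
    · rw [Set.indicator_of_notMem ho, abs_zero, zero_mul]; positivity
  refine ⟨i0.add (integrable_finsetSum _ fun c _ => i2 c), ?_⟩
  rw [integral_add i0 (integrable_finsetSum _ fun c _ => i2 c),
    integral_finsetSum _ fun c _ => i2 c]
  simp only [truncatedIF]
  rw [integral_add i0 (integrable_finsetSum _ fun c _ => i1 c),
    integral_finsetSum _ fun c _ => i1 c]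
  congr 1
  refine Finset.sum_congr rfl fun c _ => ?_
  exact integral_indicator_mul_psi hδ (hd c)
    ⟨B, fun x => (hB _ (cellProb_mem_cellSimplex P x)).2 c⟩ _ _ _

/-- The second-order remainder of the von Mises expansion of `plugIn F`. -/
theorem exists_abs_plugIn_sub_le (hF : HasUniformGradient F d) (hδ : 0 < δ)
    (hP : ∀ z, ∀ᵐ o ∂(P : Measure (Obs 𝒳)), δ ≤ instrProb P z o.covariates) {ε : ℝ} (hε : 0 < ε) :
    ∃ M : ℝ, 0 ≤ M ∧ ∀ (Q : ProbabilityMeasure (Obs 𝒳)) (H τ : ℝ), 0 ≤ H → 0 < τ →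
      HellingerClose (P : Measure (Obs 𝒳)) (Q : Measure (Obs 𝒳)) H →
      |plugIn F Q - ∫ o, truncatedIF F d P δ o ∂(Q : Measure (Obs 𝒳))| ≤
        8 * ε * (τ + (8 / δ + 4 / δ ^ 2) * H / τ) + M * H := by
  obtain ⟨B, hB0, hB⟩ := hF.exists_bound
  obtain ⟨C, hC0, hC⟩ := hF.expansion ε hε
  -- `B` pays for the set where positivity of `P` fails and 8 counts the cells. Per cell, `C` comes
  -- from the Taylor remainder and `B / δ` from the products of differences. The `ε`-part stays
  -- outside `M`, as it is divided by `τ`.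
  refine ⟨B + 8 * ((C + B / δ) * (8 / δ + 4 / δ ^ 2) + B / δ * 4), by positivity,
    fun Q H τ hH hτ hPQ => ?_⟩
  have hX := Obs.measurable_covariates (𝒳 := 𝒳)
  have hS := measurableSet_positivitySet (P := P) δ
  obtain ⟨hT, hTeq⟩ := integral_truncatedIF (P := P) (Q := Q) hF hδ
  have iF : Integrable (fun o : Obs 𝒳 => F (cellProb Q o.covariates)) (Q : Measure (Obs 𝒳)) :=
    integrable_of_bound ((measurable_comp_cellProb hF.continuousOn Q).comp hX)
      fun o => (hB _ (cellProb_mem_cellSimplex Q o.covariates)).1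
  rw [plugIn, hTeq, ← integral_sub iF hT]
  set N : Set (Obs 𝒳) := Obs.covariates ⁻¹' (positivitySet P δ)ᶜ with hN_def
  have hN : MeasurableSet N := hX hS.compl
  have hPN : (P : Measure (Obs 𝒳)) N = 0 := by
    have := ae_all_iff.2 hP
    exact this
  have hQN := hPQ.measureReal_le hH hN hPN
  have hΔ := fun c : Fin 2 × Fin 2 × Fin 2 =>
    integral_indicator_cellProb_sub_sq_le hH hPQ hδ c.1 c.2.1 c.2.2
  have hΛ := fun c : Fin 2 × Fin 2 × Fin 2 => integral_instrProb_sub_sq_le hH hPQ c.2.2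
  have iN : Integrable (N.indicator fun _ => (1 : ℝ)) (Q : Measure (Obs 𝒳)) :=
    (integrable_const _).indicator hN
  have iΔ : ∀ c : Fin 2 × Fin 2 × Fin 2, Integrable (fun o : Obs 𝒳 =>
      (positivitySet P δ).indicator (fun x => (cellProb Q x c.1 c.2.1 c.2.2 -
        cellProb P x c.1 c.2.1 c.2.2) ^ 2) o.covariates) (Q : Measure (Obs 𝒳)) := by
    intro c
    refine integrable_of_bound (((((measurable_cellProb Q _ _ _).sub
      (measurable_cellProb P _ _ _)).pow_const 2).indicator hS).comp hX) (B := 1) fun o => ?_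
    by_cases ho : o.covariates ∈ positivitySet P δ
    · rw [Set.indicator_of_mem ho, abs_of_nonneg (sq_nonneg _)]
      exact sq_sub_le_one (cellProb_mem_Icc _ _ _ _ _) (cellProb_mem_Icc _ _ _ _ _)
    · rw [Set.indicator_of_notMem ho, abs_zero]; exact zero_le_one
  have iΛ : ∀ c : Fin 2 × Fin 2 × Fin 2, Integrable (fun o : Obs 𝒳 =>
      (instrProb Q c.2.2 o.covariates - instrProb P c.2.2 o.covariates) ^ 2)
      (Q : Measure (Obs 𝒳)) := by
    intro c
    refine integrable_of_bound ((((measurable_instrProb Q _).sub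
      (measurable_instrProb P _)).pow_const 2).comp hX) (B := 1) fun o => ?_
    rw [abs_of_nonneg (sq_nonneg _)]
    exact sq_sub_le_one (instrProb_mem_Icc _ _ _) (instrProb_mem_Icc _ _ _)
  set A := ε / τ + C + B / δ with hA
  have iS : ∀ c : Fin 2 × Fin 2 × Fin 2, Integrable (fun o : Obs 𝒳 => ε * τ +
      (A * (positivitySet P δ).indicator (fun x => (cellProb Q x c.1 c.2.1 c.2.2 -
        cellProb P x c.1 c.2.1 c.2.2) ^ 2) o.covariates +
      B / δ * (instrProb Q c.2.2 o.covariates - instrProb P c.2.2 o.covariates) ^ 2))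
      (Q : Measure (Obs 𝒳)) := fun c =>
    (integrable_const _).add (((iΔ c).const_mul _).add ((iΛ c).const_mul _))
  have hA0 : 0 ≤ A := by positivity
  have hpt : ∀ o : Obs 𝒳, ‖F (cellProb Q o.covariates) - ((positivitySet P δ).indicator
      (fun x => F (cellProb P x)) o.covariates + ∑ c, (positivitySet P δ).indicator
      (fun x => d (cellProb P x) c) o.covariates *
        (instrProb Q c.2.2 o.covariates / instrProb P c.2.2 o.covariates) *
        (cellProb Q o.covariates c.1 c.2.1 c.2.2 - cellProb P o.covariates c.1 c.2.1 c.2.2))‖ ≤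
      B * N.indicator (fun _ => (1 : ℝ)) o + ∑ c : Fin 2 × Fin 2 × Fin 2, (ε * τ +
      (A * (positivitySet P δ).indicator (fun x => (cellProb Q x c.1 c.2.1 c.2.2 -
        cellProb P x c.1 c.2.1 c.2.2) ^ 2) o.covariates +
      B / δ * (instrProb Q c.2.2 o.covariates - instrProb P c.2.2 o.covariates) ^ 2)) := by
    intro o
    rw [Real.norm_eq_abs]
    have hQs := cellProb_mem_cellSimplex Q o.covariates
    have hPs := cellProb_mem_cellSimplex P o.covariates
    by_cases ho : o.covariates ∈ positivitySet P δ
    · have hoN : o ∉ N := fun h => h ho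
      simp only [Set.indicator_of_mem ho, Set.indicator_of_notMem hoN, mul_zero, zero_add]
      have hC' := hC _ hPs _ hQs
      have hB' := (hB _ hPs).2
      generalize cellProb Q o.covariates = q at *
      generalize cellProb P o.covariates = p at *
      -- Writing `λ_Q/λ_P = 1 + (λ_Q - λ_P)/λ_P` separates the Taylor remainder of `F` from the
      -- products of two differences.
      have hsplit : F q - (F p + ∑ c, d p c *
          (instrProb Q c.2.2 o.covariates / instrProb P c.2.2 o.covariates) *
          (q c.1 c.2.1 c.2.2 - p c.1 c.2.1 c.2.2)) =
          (F q - F p - ∑ c, d p c * (q c.1 c.2.1 c.2.2 - p c.1 c.2.1 c.2.2)) -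
          ∑ c, d p c * ((instrProb Q c.2.2 o.covariates - instrProb P c.2.2 o.covariates) /
            instrProb P c.2.2 o.covariates) * (q c.1 c.2.1 c.2.2 - p c.1 c.2.1 c.2.2) := by
        have : ∀ c : Fin 2 × Fin 2 × Fin 2, d p c *
            (instrProb Q c.2.2 o.covariates / instrProb P c.2.2 o.covariates) *
            (q c.1 c.2.1 c.2.2 - p c.1 c.2.1 c.2.2) =
            d p c * (q c.1 c.2.1 c.2.2 - p c.1 c.2.1 c.2.2) +
            d p c * ((instrProb Q c.2.2 o.covariates - instrProb P c.2.2 o.covariates) /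
            instrProb P c.2.2 o.covariates) * (q c.1 c.2.1 c.2.2 - p c.1 c.2.1 c.2.2) := by
          intro c
          have h1 : δ ≤ instrProb P c.2.2 o.covariates := ho _
          have h2 : instrProb P c.2.2 o.covariates ≠ 0 := (hδ.trans_le h1).ne'
          field_simp
          ring
        simp_rw [this]
        rw [Finset.sum_add_distrib]
        ring
      rw [hsplit]
      refine (abs_sub _ _).trans ((add_le_add hC' (Finset.abs_sum_le_sum_abs _ _)).trans ?_)
      rw [Finset.mul_sum, Finset.mul_sum, ← Finset.sum_add_distrib, ← Finset.sum_add_distrib]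
      refine Finset.sum_le_sum fun c _ => ?_
      have h1 : δ ≤ instrProb P c.2.2 o.covariates := ho _
      have h3 := abs_le_add_sq_div (q c.1 c.2.1 c.2.2 - p c.1 c.2.1 c.2.2) hτ
      have h4 := hB' c
      generalize q c.1 c.2.1 c.2.2 - p c.1 c.2.1 c.2.2 = v at *
      have h2 : 0 < instrProb P c.2.2 o.covariates := hδ.trans_le h1
      rw [abs_mul, abs_mul, abs_div, abs_of_pos h2]
      generalize instrProb Q c.2.2 o.covariates - instrProb P c.2.2 o.covariates = w at *
      have h5 : |d p c| * (|w| / instrProb P c.2.2 o.covariates) * |v| ≤ B * (|w| / δ) * |v| := by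
        gcongr
      have h6 : |w| * |v| ≤ w ^ 2 + v ^ 2 := by
        rw [← sq_abs w, ← sq_abs v]; nlinarith [sq_nonneg (|w| - |v|), sq_nonneg |w|, sq_nonneg |v|]
      have h7 : B * (|w| / δ) * |v| ≤ B / δ * (w ^ 2 + v ^ 2) := by
        calc _ = B / δ * (|w| * |v|) := by ring
          _ ≤ _ := mul_le_mul_of_nonneg_left h6 (by positivity)
      have h8 : ε * |v| ≤ ε * (τ + v ^ 2 / τ) := mul_le_mul_of_nonneg_left h3 hε.le
      calc _ ≤ ε * (τ + v ^ 2 / τ) + C * v ^ 2 + B / δ * (w ^ 2 + v ^ 2) := by linarith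
        _ = _ := by rw [hA]; ring
    -- Where positivity fails the truncated terms vanish and only `|F| ≤ B` is left; the mass of
    -- this set is at most `H`.
    · have hoN : o ∈ N := ho
      simp only [Set.indicator_of_notMem ho, Set.indicator_of_mem hoN, mul_one, zero_mul,
        mul_zero, Finset.sum_const_zero, add_zero, sub_zero, zero_add]
      have h0 : 0 ≤ ∑ c : Fin 2 × Fin 2 × Fin 2, (ε * τ + B / δ *
          (instrProb Q c.2.2 o.covariates - instrProb P c.2.2 o.covariates) ^ 2) :=
        Finset.sum_nonneg fun c _ => by positivity
      linarith [(hB _ hQs).1]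
  have iR := (iN.const_mul B).add (integrable_finsetSum Finset.univ fun c _ => iS c)
  have hle := norm_integral_le_of_norm_le iR (Eventually.of_forall hpt)
  rw [Real.norm_eq_abs] at hle
  refine hle.trans ?_
  simp only [Pi.add_apply]
  rw [integral_add (iN.const_mul B) (integrable_finsetSum Finset.univ fun c _ => iS c),
    integral_finsetSum _ fun c _ => iS c, integral_const_mul, integral_indicator_const _ hN]
  have hsum : ∀ c : Fin 2 × Fin 2 × Fin 2, ∫ o : Obs 𝒳, (ε * τ +
      (A * (positivitySet P δ).indicator (fun x => (cellProb Q x c.1 c.2.1 c.2.2 -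
        cellProb P x c.1 c.2.1 c.2.2) ^ 2) o.covariates +
      B / δ * (instrProb Q c.2.2 o.covariates - instrProb P c.2.2 o.covariates) ^ 2))
      ∂(Q : Measure (Obs 𝒳)) ≤
      ε * τ + (A * ((8 / δ + 4 / δ ^ 2) * H) + B / δ * (4 * H)) := by
    intro c
    have i1 : Integrable (fun o : Obs 𝒳 => A * (positivitySet P δ).indicator (fun x =>
        (cellProb Q x c.1 c.2.1 c.2.2 - cellProb P x c.1 c.2.1 c.2.2) ^ 2) o.covariates +
        B / δ * (instrProb Q c.2.2 o.covariates - instrProb P c.2.2 o.covariates) ^ 2)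
        (Q : Measure (Obs 𝒳)) := ((iΔ c).const_mul _).add ((iΛ c).const_mul _)
    rw [integral_add (integrable_const _) i1,
      integral_add ((iΔ c).const_mul _) ((iΛ c).const_mul _), integral_const_mul A,
      integral_const_mul (B / δ), integral_const]
    simp only [probReal_univ, one_smul]
    have h1 := mul_le_mul_of_nonneg_left (hΔ c) hA0
    have h2 := mul_le_mul_of_nonneg_left (hΛ c) (by positivity : 0 ≤ B / δ)
    linarith
  have h1 := Finset.sum_le_sum fun c (_ : c ∈ Finset.univ) => hsum c
  rw [Finset.sum_const, Finset.card_univ] at h1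
  have hcard : Fintype.card (Fin 2 × Fin 2 × Fin 2) = 8 := by simp
  rw [hcard] at h1
  have h2 := mul_le_mul_of_nonneg_left hQN hB0
  simp only [smul_eq_mul, mul_one, nsmul_eq_mul, Nat.cast_ofNat] at h1 ⊢
  refine (add_le_add h2 h1).trans (le_of_eq ?_)
  rw [hA]
  field_simp
  ring

end PlugIn

/-! ### Pathwise differentiability of plug-in functionals -/

section PlugIn

variable {𝒳 : Type*} [MeasurableSpace 𝒳] {P : ProbabilityMeasure (Obs 𝒳)} {δ : ℝ}
  {F : (Fin 2 → Fin 2 → Fin 2 → ℝ) → ℝ}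
  {d : (Fin 2 → Fin 2 → Fin 2 → ℝ) → Fin 2 × Fin 2 × Fin 2 → ℝ}

/-- The expansion at `Q = P` with `H = 0` leaves the error `8 ε τ`, and `τ > 0` is arbitrary. -/
theorem plugIn_eq_integral_truncatedIF (hF : HasUniformGradient F d) (hδ : 0 < δ)
    (hP : ∀ z, ∀ᵐ o ∂(P : Measure (Obs 𝒳)), δ ≤ instrProb P z o.covariates) :
    plugIn F P = ∫ o, truncatedIF F d P δ o ∂(P : Measure (Obs 𝒳)) := by
  obtain ⟨M, -, hM⟩ := exists_abs_plugIn_sub_le hF hδ hP one_pos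
  have hclose : HellingerClose (P : Measure (Obs 𝒳)) (P : Measure (Obs 𝒳)) 0 := by
    intro f _ _
    simp
  have key : |plugIn F P - ∫ o, truncatedIF F d P δ o ∂(P : Measure (Obs 𝒳))| ≤ 0 := by
    refine le_of_forall_pos_le_add fun η hη => ?_
    have := hM P 0 (η / 8) le_rfl (by positivity) hclose
    simp only [mul_zero, zero_div, add_zero, mul_one] at this
    linarith
  exact sub_eq_zero.1 (abs_nonpos_iff.1 key)

theorem plugInIF_ae_eq (hP : ∀ z, ∀ᵐ o ∂(P : Measure (Obs 𝒳)), δ ≤ instrProb P z o.covariates) :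
    plugInIF F d P =ᵐ[(P : Measure (Obs 𝒳))]
      fun o => truncatedIF F d P δ o - plugIn F P := by
  filter_upwards [ae_all_iff.2 hP] with o ho
  have ho : o.covariates ∈ positivitySet P δ := ho
  simp only [plugInIF, truncatedIF, Set.indicator_of_mem ho]
  ring

/-- Total mass is constant along the path: differentiate the expectation of `1`. -/
theorem IsRegularSubmodel.integral_score_eq_zero {Ω : Type*} [MeasurableSpace Ω]
    {model : Set (ProbabilityMeasure Ω)} {P : ProbabilityMeasure Ω} {path : ℝ → ProbabilityMeasure Ω}
    {u : Ω → ℝ} (hS : IsRegularSubmodel model P path u) : ∫ o, u o ∂(P : Measure Ω) = 0 := by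
  have h := hS.exists_hellingerClose_and_tendsto.2 (fun _ => 1) measurable_const ⟨1, by simp⟩
  simp only [integral_const, probReal_univ, sub_self, zero_div, one_mul] at h
  exact tendsto_nhds_unique h tendsto_const_nhds

/-- The difference quotient splits into the von Mises remainder over `t`, which vanishes in the
limit, and the difference quotient of the expectation of one fixed bounded function. -/
theorem hasDerivAt_plugIn (hF : HasUniformGradient F d) (hδ : 0 < δ)
    (hP : ∀ z, ∀ᵐ o ∂(P : Measure (Obs 𝒳)), δ ≤ instrProb P z o.covariates)
    {model : Set (ProbabilityMeasure (Obs 𝒳))} {path : ℝ → ProbabilityMeasure (Obs 𝒳)}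
    {u : Obs 𝒳 → ℝ} (hS : IsRegularSubmodel model P path u) :
    HasDerivAt (fun t => plugIn F (path t))
      (∫ o, plugInIF F d P o * u o ∂(P : Measure (Obs 𝒳))) 0 := by
  obtain ⟨⟨C, hC0, hC⟩, hlin⟩ := hS.exists_hellingerClose_and_tendsto
  have hΨm := measurable_truncatedIF (P := P) (δ := δ) hF
  have hΨb := exists_bound_truncatedIF (P := P) hF hδ
  have hΨ := hlin _ hΨm hΨb
  have hu : Integrable u (P : Measure (Obs 𝒳)) := hS.memLp_score.integrable one_le_two
  have hΨu : Integrable (fun o => truncatedIF F d P δ o * u o) (P : Measure (Obs 𝒳)) := by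
    obtain ⟨B, hB⟩ := hΨb
    exact (memLp_two_of_bound hΨm hB).integrable_mul hS.memLp_score
  have hval : ∫ o, plugInIF F d P o * u o ∂(P : Measure (Obs 𝒳)) =
      ∫ o, truncatedIF F d P δ o * u o ∂(P : Measure (Obs 𝒳)) := by
    have h1 : ∫ o, plugInIF F d P o * u o ∂(P : Measure (Obs 𝒳)) =
        ∫ o, (truncatedIF F d P δ o * u o - plugIn F P * u o) ∂(P : Measure (Obs 𝒳)) := by
      refine integral_congr_ae ?_
      filter_upwards [plugInIF_ae_eq (F := F) (d := d) hP] with o ho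
      rw [ho, sub_mul]
    rw [h1, integral_sub hΨu (hu.const_mul _), integral_const_mul, hS.integral_score_eq_zero,
      mul_zero, sub_zero]
  rw [hasDerivAt_iff_tendsto_slope_zero, hval]
  have hrem : Tendsto (fun t : ℝ => (plugIn F (path t) -
      ∫ o, truncatedIF F d P δ o ∂(path t : Measure (Obs 𝒳))) / t) (𝓝[≠] 0) (𝓝 0) := by
    rw [Metric.tendsto_nhds]
    intro η hη
    set κ := 8 / δ + 4 / δ ^ 2 with hκ
    have hκ0 : 0 ≤ κ := by positivity
    -- With `H = C t²` and `τ = |t|` the `ε`-part of the remainder is `8 ε (1 + κ C) |t|`, which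
    -- this choice makes `(η/2) |t|`. The rest is `M C t²`, below `(η/2) |t|` for small `t`.
    set ε := η / (16 * (1 + κ * C)) with hε
    have hε0 : 0 < ε := by positivity
    obtain ⟨M, hM0, hM⟩ := exists_abs_plugIn_sub_le hF hδ hP hε0
    have hsmall : ∀ᶠ t : ℝ in 𝓝[≠] 0, M * C * |t| < η / 2 := by
      have h1 : Tendsto (fun t : ℝ => M * C * |t|) (𝓝 0) (𝓝 (M * C * |(0 : ℝ)|)) :=
        (by fun_prop : Continuous fun t : ℝ => M * C * |t|).tendsto 0
      rw [abs_zero, mul_zero] at h1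
      exact (h1.mono_left nhdsWithin_le_nhds).eventually_lt_const (by positivity)
    filter_upwards [hC, hsmall, self_mem_nhdsWithin] with t h1 h2 ht0
    have ht0 : 0 < |t| := abs_pos.2 ht0
    have h3 := hM (path t) (C * t ^ 2) |t| (by positivity) ht0 h1
    rw [Real.dist_eq, sub_zero, abs_div, div_lt_iff₀ ht0]
    refine h3.trans_lt ?_
    have h4 : 8 * ε * (|t| + κ * (C * t ^ 2) / |t|) + M * (C * t ^ 2) =
        (8 * ε * (1 + κ * C) + M * C * |t|) * |t| := by
      rw [← sq_abs t]
      field_simp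
    have h5 : 8 * ε * (1 + κ * C) = η / 2 := by
      rw [hε]
      have : 1 + κ * C ≠ 0 := by positivity
      field_simp
      norm_num
    rw [h4, h5]
    exact mul_lt_mul_of_pos_right (by linarith) ht0
  have hsum := hrem.add hΨ
  rw [zero_add] at hsum
  refine hsum.congr fun t => ?_
  rw [zero_add, hS.through, plugIn_eq_integral_truncatedIF hF hδ hP, smul_eq_mul]
  ring

/-- The influence function of a differentiable functional of the conditional cell probabilities. -/
theorem isInfluenceFunction_plugIn (hF : HasUniformGradient F d) (hP : P ∈ positivityModel 𝒳) :
    IsInfluenceFunction (positivityModel 𝒳) (plugIn F) P (plugInIF F d P) := by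
  obtain ⟨δ, hδ, hP⟩ := mem_positivityModel_iff.1 hP
  have hae := plugInIF_ae_eq (F := F) (d := d) hP
  have hΨm := measurable_truncatedIF (P := P) (δ := δ) hF
  obtain ⟨B, hB⟩ := exists_bound_truncatedIF (P := P) hF hδ
  refine ⟨(memLp_congr_ae hae).2 ((memLp_two_of_bound hΨm hB).sub (memLp_const _)), ?_,
    fun path u hS => hasDerivAt_plugIn hF hδ hP hS⟩
  rw [integral_congr_ae hae, integral_sub (integrable_of_bound hΨm hB) (integrable_const _),
    ← plugIn_eq_integral_truncatedIF hF hδ hP]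
  simp

end PlugIn

/-! ### Smooth functions of the Balke–Pearl expressions -/

/-- A first order expansion of a `C¹` function that is uniform on a compact convex set. -/
theorem ContDiffOn.exists_uniform_expansion {E : Type*} [NormedAddCommGroup E] [NormedSpace ℝ E]
    {g : E → ℝ} {K : Set E} (hg : ContDiffOn ℝ 1 g K) (hK : IsCompact K) (hKc : Convex ℝ K)
    (hKu : UniqueDiffOn ℝ K) {ε : ℝ} (hε : 0 < ε) :
    ∃ C : ℝ, 0 ≤ C ∧ ∀ v ∈ K, ∀ w ∈ K,
      |g w - g v - fderivWithin ℝ g K v (w - v)| ≤ ε * ‖w - v‖ + C * ‖w - v‖ ^ 2 := by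
  have hc := hg.continuousOn_fderivWithin hKu le_rfl
  obtain ⟨η, hη, hηK⟩ := Metric.uniformContinuousOn_iff.1
    (hK.uniformContinuousOn_of_continuous hc) ε hε
  obtain ⟨L, hL⟩ := hK.exists_bound_of_continuousOn hc
  have hd : ∀ x ∈ K, HasFDerivWithinAt g (fderivWithin ℝ g K x) K x := fun x hx =>
    ((hg.differentiableOn one_ne_zero) x hx).hasFDerivWithinAt
  refine ⟨2 * |L| / η, by positivity, fun v hv w hw => ?_⟩
  rw [← Real.norm_eq_abs]
  -- Near `v` the derivative is within `ε` of its value at `v`, by uniform continuity on `K`, and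
  -- the mean value inequality applies on the convex set `K ∩ ball v η`.
  rcases lt_or_ge ‖w - v‖ η with hlt | hge
  · have h1 := (hKc.inter (convex_ball v η)).norm_image_sub_le_of_norm_hasFDerivWithin_le'
      (f := g) (φ := fderivWithin ℝ g K v) (C := ε)
      (fun x hx => (hd x hx.1).mono Set.inter_subset_left)
      (fun x hx => by
        rw [← dist_eq_norm]
        exact (hηK x hx.1 v hv hx.2).le)
      ⟨hv, Metric.mem_ball_self hη⟩ ⟨hw, by rwa [Metric.mem_ball, dist_eq_norm]⟩
    have : 0 ≤ 2 * |L| / η * ‖w - v‖ ^ 2 := by positivity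
    linarith
  -- Far from `v` the crude linear bound `2 |L| ‖w - v‖` suffices: `‖w - v‖ ≥ η` absorbs it into the
  -- quadratic term.
  · have h1 := hKc.norm_image_sub_le_of_norm_hasFDerivWithin_le'
      (f := g) (φ := fderivWithin ℝ g K v) (C := 2 * |L|) hd
      (fun x hx => (norm_sub_le _ _).trans (by
        linarith [hL x hx, hL v hv, le_abs_self L])) hv hw
    have h2 : 2 * |L| * ‖w - v‖ ≤ 2 * |L| / η * ‖w - v‖ ^ 2 := by
      rw [div_mul_eq_mul_div, le_div_iff₀ hη]
      nlinarith [mul_nonneg (mul_nonneg zero_le_two (abs_nonneg L)) (norm_nonneg (w - v))]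
    have : 0 ≤ ε * ‖w - v‖ := by positivity
    linarith

theorem fderivWithin_eq_sum_partialDeriv (K : Set (Fin 8 → ℝ)) (g : (Fin 8 → ℝ) → ℝ)
    (v w : Fin 8 → ℝ) : fderivWithin ℝ g K v w = ∑ j, partialDeriv K g j v * w j := by
  conv_lhs => rw [pi_eq_sum_univ' w]
  rw [map_sum]
  refine Finset.sum_congr rfl fun j _ => ?_
  rw [map_smul, smul_eq_mul, mul_comm, partialDeriv]

/-- The chain rule for an affine map into the cube. Describing `θ` through its increments lets the
additive constant drop out. The nondegenerate cube has unique derivatives within it, so the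
one-sided partial derivatives at the boundary are well defined and continuous. -/
theorem hasUniformGradient_comp_affine {lo hi : Fin 8 → ℝ} (hlt : ∀ j, lo j < hi j)
    {g : (Fin 8 → ℝ) → ℝ} (hg : ContDiffOn ℝ 1 g (Set.Icc lo hi))
    {θ : (Fin 2 → Fin 2 → Fin 2 → ℝ) → Fin 8 → ℝ} {m : Fin 8 → Fin 2 × Fin 2 × Fin 2 → ℝ}
    (hm : ∀ j c, |m j c| ≤ 1)
    (hθ : ∀ p p' j, θ p' j - θ p j = ∑ c, m j c * (p' c.1 c.2.1 c.2.2 - p c.1 c.2.1 c.2.2))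
    (hmaps : ∀ p ∈ cellSimplex, θ p ∈ Set.Icc lo hi) :
    HasUniformGradient (fun p => g (θ p))
      (fun p c => ∑ j, partialDeriv (Set.Icc lo hi) g j (θ p) * m j c) := by
  have hKu : UniqueDiffOn ℝ (Set.Icc lo hi) := by
    rw [← Set.pi_univ_Icc]
    exact UniqueDiffOn.univ_pi fun j => uniqueDiffOn_Icc (hlt j)
  have hθc : Continuous θ := by
    have : θ = fun p j => θ 0 j + ∑ c, m j c * p c.1 c.2.1 c.2.2 := by
      ext p j
      have := hθ 0 p j
      simp only [Pi.zero_apply, sub_zero] at this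
      linarith
    rw [this]
    fun_prop
  have hc := hg.continuousOn_fderivWithin hKu le_rfl
  refine ⟨hg.continuousOn.comp hθc.continuousOn hmaps, fun c => ?_, fun ε hε => ?_⟩
  · refine continuousOn_finsetSum _ fun j _ => ContinuousOn.mul ?_ continuousOn_const
    have h1 : ContinuousOn (fun v => partialDeriv (Set.Icc lo hi) g j v) (Set.Icc lo hi) :=
      hc.clm_apply continuousOn_const
    exact h1.comp hθc.continuousOn hmaps
  · obtain ⟨C, hC0, hC⟩ := hg.exists_uniform_expansion isCompact_Icc (convex_Icc lo hi) hKu hε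
    refine ⟨8 * C, by positivity, fun p hp p' hp' => ?_⟩
    have h1 := hC _ (hmaps p hp) _ (hmaps p' hp')
    have h2 : fderivWithin ℝ g (Set.Icc lo hi) (θ p) (θ p' - θ p) =
        ∑ c, (∑ j, partialDeriv (Set.Icc lo hi) g j (θ p) * m j c) *
          (p' c.1 c.2.1 c.2.2 - p c.1 c.2.1 c.2.2) := by
      rw [fderivWithin_eq_sum_partialDeriv]
      simp_rw [Pi.sub_apply, hθ, Finset.mul_sum, Finset.sum_mul, mul_assoc]
      exact Finset.sum_comm
    rw [h2] at h1
    refine h1.trans ?_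
    have h3 : ‖θ p' - θ p‖ ≤ ∑ c : Fin 2 × Fin 2 × Fin 2,
        |p' c.1 c.2.1 c.2.2 - p c.1 c.2.1 c.2.2| := by
      refine (pi_norm_le_iff_of_nonneg (Finset.sum_nonneg fun c _ => abs_nonneg _)).2 fun j => ?_
      rw [Pi.sub_apply, hθ, Real.norm_eq_abs]
      refine (Finset.abs_sum_le_sum_abs _ _).trans (Finset.sum_le_sum fun c _ => ?_)
      rw [abs_mul]
      exact mul_le_of_le_one_left (abs_nonneg _) (hm j c)
    have h4 : ‖θ p' - θ p‖ ^ 2 ≤ 8 * ∑ c : Fin 2 × Fin 2 × Fin 2,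
        (p' c.1 c.2.1 c.2.2 - p c.1 c.2.1 c.2.2) ^ 2 := by
      refine (pow_le_pow_left₀ (norm_nonneg _) h3 2).trans ?_
      -- Cauchy–Schwarz over the 8 cells, the source of the constant `8 * C`.
      have := sq_sum_le_card_mul_sum_sq (s := (Finset.univ : Finset (Fin 2 × Fin 2 × Fin 2)))
        (f := fun c => |p' c.1 c.2.1 c.2.2 - p c.1 c.2.1 c.2.2|)
      simp only [sq_abs] at this
      refine this.trans (le_of_eq ?_)
      simp
    have h5 := mul_le_mul_of_nonneg_left h3 hε.le
    have h6 := mul_le_mul_of_nonneg_left h4 hC0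
    linarith

/-! ### The Balke–Pearl forms as affine maps into the cubes -/

/-- The coefficient of `p y a z`, where `c = (y, a, z)`, in a linear form in the `p y a z`. -/
def cellCoeff (form : (Fin 2 → Fin 2 → Fin 2 → ℝ) → Fin 8 → ℝ) (j : Fin 8)
    (c : Fin 2 × Fin 2 × Fin 2) : ℝ :=
  form (fun y a z => if c = (y, a, z) then 1 else 0) j

theorem lowerForm_zero_eq_sum (p : Fin 2 → Fin 2 → Fin 2 → ℝ) (j : Fin 8) :
    lowerForm 0 p j = ∑ c, cellCoeff (lowerForm 0) j c * p c.1 c.2.1 c.2.2 := by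
  simp only [Fintype.sum_prod_type, Fin.sum_univ_two, cellCoeff]
  fin_cases j <;> simp [lowerForm] <;> ring

theorem upperForm_zero_eq_sum (p : Fin 2 → Fin 2 → Fin 2 → ℝ) (j : Fin 8) :
    upperForm 0 p j = ∑ c, cellCoeff (upperForm 0) j c * p c.1 c.2.1 c.2.2 := by
  simp only [Fintype.sum_prod_type, Fin.sum_univ_two, cellCoeff]
  fin_cases j <;> simp [upperForm] <;> ring

theorem lowerForm_one_sub (p p' : Fin 2 → Fin 2 → Fin 2 → ℝ) (j : Fin 8) :
    lowerForm 1 p' j - lowerForm 1 p j = lowerForm 0 (p' - p) j := by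
  fin_cases j <;> simp [lowerForm] <;> ring

theorem upperForm_one_sub (p p' : Fin 2 → Fin 2 → Fin 2 → ℝ) (j : Fin 8) :
    upperForm 1 p' j - upperForm 1 p j = upperForm 0 (p' - p) j := by
  fin_cases j <;> simp [upperForm] <;> ring

theorem abs_cellCoeff_lowerForm_le (j : Fin 8) (c : Fin 2 × Fin 2 × Fin 2) :
    |cellCoeff (lowerForm 0) j c| ≤ 1 := by
  obtain ⟨y, a, z⟩ := c
  fin_cases j <;> fin_cases y <;> fin_cases a <;> fin_cases z <;> simp [cellCoeff, lowerForm]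

theorem abs_cellCoeff_upperForm_le (j : Fin 8) (c : Fin 2 × Fin 2 × Fin 2) :
    |cellCoeff (upperForm 0) j c| ≤ 1 := by
  obtain ⟨y, a, z⟩ := c
  fin_cases j <;> fin_cases y <;> fin_cases a <;> fin_cases z <;> simp [cellCoeff, upperForm]

theorem lowerForm_one_mem_lowerCube {p : Fin 2 → Fin 2 → Fin 2 → ℝ} (hp : p ∈ cellSimplex) :
    lowerForm 1 p ∈ lowerCube := by
  obtain ⟨h0, h1⟩ := hp
  have s0 := h1 0
  have s1 := h1 1
  simp only [Fin.sum_univ_two] at s0 s1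
  have := h0 0 0 0; have := h0 0 0 1; have := h0 0 1 0; have := h0 0 1 1
  have := h0 1 0 0; have := h0 1 0 1; have := h0 1 1 0; have := h0 1 1 1
  constructor <;> intro j <;> fin_cases j <;> simp [lowerForm] <;> linarith

theorem upperForm_one_mem_upperCube {p : Fin 2 → Fin 2 → Fin 2 → ℝ} (hp : p ∈ cellSimplex) :
    upperForm 1 p ∈ upperCube := by
  obtain ⟨h0, h1⟩ := hp
  have s0 := h1 0
  have s1 := h1 1
  simp only [Fin.sum_univ_two] at s0 s1
  have := h0 0 0 0; have := h0 0 0 1; have := h0 0 1 0; have := h0 0 1 1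
  have := h0 1 0 0; have := h0 1 0 1; have := h0 1 1 0; have := h0 1 1 1
  constructor <;> intro j <;> fin_cases j <;> simp [upperForm] <;> linarith

theorem isInfluenceFunction_lowerIF {𝒳 : Type*} [MeasurableSpace 𝒳]
    {P : ProbabilityMeasure (Obs 𝒳)} (hP : P ∈ positivityModel 𝒳) {g : (Fin 8 → ℝ) → ℝ}
    (hg : ContDiffOn ℝ 1 g lowerCube) :
    IsInfluenceFunction (positivityModel 𝒳) (lowerFunctional g) P (lowerIF g P) := by
  have hF := hasUniformGradient_comp_affine (fun _ => by norm_num) hg abs_cellCoeff_lowerForm_le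
    (θ := lowerForm 1) (fun p p' j => by
      rw [lowerForm_one_sub, lowerForm_zero_eq_sum]; rfl)
    fun p hp => lowerForm_one_mem_lowerCube hp
  have hIF : lowerIF g P = plugInIF (fun p => g (lowerForm 1 p)) (fun p c =>
      ∑ j, partialDeriv lowerCube g j (lowerForm 1 p) * cellCoeff (lowerForm 0) j c) P := by
    ext o
    have : ∑ j, partialDeriv lowerCube g j (thetaLower P o.covariates) * corrLower P o j =
        ∑ c, (∑ j, partialDeriv lowerCube g j (lowerForm 1 (cellProb P o.covariates)) *
          cellCoeff (lowerForm 0) j c) * psi P o c.1 c.2.1 c.2.2 := by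
      simp_rw [corrLower, lowerForm_zero_eq_sum (psi P o), Finset.mul_sum, Finset.sum_mul, mul_assoc]
      exact Finset.sum_comm
    rw [lowerIF, this]
    rfl
  rw [hIF]
  exact isInfluenceFunction_plugIn hF hP

theorem isInfluenceFunction_upperIF {𝒳 : Type*} [MeasurableSpace 𝒳]
    {P : ProbabilityMeasure (Obs 𝒳)} (hP : P ∈ positivityModel 𝒳) {h : (Fin 8 → ℝ) → ℝ}
    (hh : ContDiffOn ℝ 1 h upperCube) :
    IsInfluenceFunction (positivityModel 𝒳) (upperFunctional h) P (upperIF h P) := by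
  have hF := hasUniformGradient_comp_affine (fun _ => by norm_num) hh abs_cellCoeff_upperForm_le
    (θ := upperForm 1) (fun p p' j => by
      rw [upperForm_one_sub, upperForm_zero_eq_sum]; rfl)
    fun p hp => upperForm_one_mem_upperCube hp
  have hIF : upperIF h P = plugInIF (fun p => h (upperForm 1 p)) (fun p c =>
      ∑ j, partialDeriv upperCube h j (upperForm 1 p) * cellCoeff (upperForm 0) j c) P := by
    ext o
    have : ∑ j, partialDeriv upperCube h j (thetaUpper P o.covariates) * corrUpper P o j =
        ∑ c, (∑ j, partialDeriv upperCube h j (upperForm 1 (cellProb P o.covariates)) *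
          cellCoeff (upperForm 0) j c) * psi P o c.1 c.2.1 c.2.2 := by
      simp_rw [corrUpper, upperForm_zero_eq_sum (psi P o), Finset.mul_sum, Finset.sum_mul, mul_assoc]
      exact Finset.sum_comm
    rw [upperIF, this]
    rfl
  rw [hIF]
  exact isInfluenceFunction_plugIn hF hP

/-! ### Existence and uniqueness for both bounds -/

theorem theorem3 {𝒳 : Type*} [MeasurableSpace 𝒳]
    (P : ProbabilityMeasure (Obs 𝒳)) (hP : P ∈ positivityModel 𝒳)
    (g h : (Fin 8 → ℝ) → ℝ)
    (hg : ContDiffOn ℝ 1 g lowerCube) (hh : ContDiffOn ℝ 1 h upperCube) :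
    (IsInfluenceFunction (positivityModel 𝒳) (lowerFunctional g) P (lowerIF g P) ∧
      ∀ φ : Obs 𝒳 → ℝ,
        IsInfluenceFunction (positivityModel 𝒳) (lowerFunctional g) P φ →
          φ =ᵐ[(P : Measure (Obs 𝒳))] lowerIF g P) ∧
    (IsInfluenceFunction (positivityModel 𝒳) (upperFunctional h) P (upperIF h P) ∧
      ∀ φ : Obs 𝒳 → ℝ,
        IsInfluenceFunction (positivityModel 𝒳) (upperFunctional h) P φ →
          φ =ᵐ[(P : Measure (Obs 𝒳))] upperIF h P) := by
  have hl := isInfluenceFunction_lowerIF hP hg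
  have hu := isInfluenceFunction_upperIF hP hh
  have hmodel : ∀ Q : ProbabilityMeasure (Obs 𝒳),
      (∀ s, MeasurableSet s → (P : Measure (Obs 𝒳)) s ≤ 2 * (Q : Measure (Obs 𝒳)) s) →
      (∀ s, MeasurableSet s → (Q : Measure (Obs 𝒳)) s ≤ 2 * (P : Measure (Obs 𝒳)) s) →
      Q ∈ positivityModel 𝒳 := fun _ hPQ hQP => mem_positivityModel_of_le hP hPQ hQP
  exact ⟨⟨hl, fun φ hφ => hφ.ae_eq hmodel hl⟩, hu, fun φ hφ => hφ.ae_eq hmodel hu⟩
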